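/- Let $p\ge 1$, and for a symmetric matrix $\theta\in\mathbb R^{p\times p}$ let $f_\theta$ be the probability mass function on $\{0,1\}^p$ with $$f_\theta(x)\propto\exp\Big(\sum_{j}\theta_{jj}x_j+\sum_{i<j}\theta_{ij}x_ix_j\Big).$$ Let $Z\in\{0,1\}^{n\times p}$ have independent rows with mass function $f_{\theta_\star}$ for a symmetric $\theta_\star$, and write $\mathbb E^{(n)}$ for the expectation over $Z$. For $\theta\in\mathbb R^{p\times p}$ (not necessarily symmetric) let $\theta_{\cdot j}$ be its $j$-th column and $$q_{n,\theta}(Z)=\prod_{j=1}^p\prod_{i=1}^n\frac{\exp\big(Z_{ij}(\theta_{jj}+\sum_{k\ne j}\theta_{kj}Z_{ik})\big)}{1+\exp\big(\theta_{jj}+\sum_{k\ne j}\theta_{kj}Z_{ik}\big)}.$$ The quasi-posterior is the probability measure on $\mathbb R^{p\times p}$ $$\check\Pi_{n,d}(d\theta\mid Z)\propto q_{n,\theta}(Z)\prod_{j=1}^p\sum_{\delta\in\{0,1\}^p}\pi_\delta\Big(\frac{\rho}{2}\Big)^{\|\delta\|_0}e^{-\rho\|\theta_{\cdot j}\|_1}\mu_{p,\delta}(d\theta_{\cdot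 j}),\qquad \rho=24\sqrt{n\log p},$$ where $\mu_{p,\delta}$ is the product measure on $\mathbb R^p$ whose $k$-th factor is Lebesgue measure if $\delta_k=1$ and the unit mass at $0$ if $\delta_k=0$. The prior weights are $\pi_\delta=g_{\|\delta\|_0}\binom{p}{\|\delta\|_0}^{-1}$, where $(g_s)_{0\le s\le p}$ is a probability distribution with $$\frac{c_1}{p^{c_3}}g_{s-1}\le g_s\le\frac{c_2}{p^{c_4}}g_{s-1},\qquad 1\le s\le p,$$ for positive constants $c_1,c_2$ and $c_3\ge c_4>0$. For $X\sim f_{\theta_\star}$ let $X_{(j)}$ be $X$ with its $j$-th coordinate replaced by $1$, let $g(x)=\log(1+e^x)$, and let $\mathcal H^{(j)}=\mathbb E\big[g''(\langle\theta_{\star\cdot j},X_{(j)}\rangle)X_{(j)}X_{(j)}'\big]$. Define $$\underline\kappa_2(s)=\min_{j}\inf\Big\{\tfrac{u'\mathcal H^{(j)}u}{\|u\|_2^2}:u\neq0,\ \|u\|_0\le s\Big\},$$ $$\underline\kappa_2=\min_{j}\inf\Big\{\tfrac{u'\mathcal H^{(j)}u}{\|u\|_2^2}:u\ne0,\ \sum_{k:\theta_{\star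 kj}=0}|u_k|\le7\sum_{k:\theta_{\star kj}\ne0}|u_k|\Big\}$$ (with $\inf\emptyset=+\infty$). Let $s_{\star j}=\|\theta_{\star\cdot j}\|_0$, $$\zeta_j=s_{\star j}+\frac4{c_4}+\frac2{c_4}\Big(1+\frac{128}{\underline\kappa_2}+\frac{s_{\star j}}{64(\log p)^2}+\frac{\log(4e)}{\log p}\Big)s_{\star j},$$ $\bar s=\max_j\lceil s_{\star j}+\zeta_j\rceil$ and $\underline\kappa=\underline\kappa(\bar s)=\min(\underline\kappa_2,\underline\kappa_2(\bar s))$. There are universal constants $A_1,A_2\in(0,\infty)$ such that for all $c_1,c_2,c_3,c_4$ as above there is a finite $M_0>2$, depending only on $c_1,c_2,c_3,c_4$, such that the following holds for all $p$ large enough (how large depends only on $c_1,\dots,c_4$), all such $(g_s)$, all symmetric $\theta_\star\in\mathbb R^{p\times p}$ with $\underline\kappa>0$, and all $n$ with $$n\ge A_1\Big(\frac{\bar s}{\underline\kappa(\bar s)}\Big)^2\log p :$$ $$\mathbb E^{(n)}\Big[\check\Pi_{n,d}\Big(\Big\{\theta\in\mathbb R^{p\times p}:\ \max_{1\le j\le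 p}\|\theta_{\cdot j}-\theta_{\star\cdot j}\|_2>\frac{M_0}{\underline\kappa_2(\bar s)}\sqrt{\frac{\bar s\log p}{n}}\Big\}\,\Big|\,Z\Big)\Big]\le 2e^{-A_2n}+\frac{12}{p}.$$ -/

import Mathlib

open MeasureTheory

namespace IsingQuasi

/-- The numerical value of a binary coordinate: a point of `{0,1}^p` is a function
`Fin p → Bool`, and `bit` reads its coordinates as the real numbers `0` and `1`. -/
def bit (b : Bool) : ℝ := if b then 1 else 0

/-! ### Vectors and matrices -/

/-- The number `‖u‖₀` of non-zero components. -/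
noncomputable def nnz {p : ℕ} (u : Fin p → ℝ) : ℕ := (Finset.univ.filter fun k => u k ≠ 0).card

/-- The `ℓ¹` norm `‖u‖₁`. -/
def norm1 {p : ℕ} (u : Fin p → ℝ) : ℝ := ∑ k, |u k|

/-- The Euclidean norm `‖u‖₂`. -/
noncomputable def norm2 {p : ℕ} (u : Fin p → ℝ) : ℝ := Real.sqrt (∑ k, u k ^ 2)

/-- The `j`-th column `θ_{·j}` of a matrix. -/
def column {p : ℕ} (θ : Matrix (Fin p) (Fin p) ℝ) (j : Fin p) : Fin p → ℝ := fun k => θ k j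

/-- The norm `max_j ‖θ_{·j}‖₂` (a supremum over a finite index set). -/
noncomputable def maxColNorm {p : ℕ} (θ : Matrix (Fin p) (Fin p) ℝ) : ℝ :=
  ⨆ j : Fin p, norm2 (column θ j)

/-! ### The Ising model and the law of the data -/

/-- The unnormalized Ising density
`exp (∑_j θ_{jj} x_j + ∑_{i<j} θ_{ij} x_i x_j)`. -/
noncomputable def isingWeight {p : ℕ} (θ : Matrix (Fin p) (Fin p) ℝ) (x : Fin p → Bool) : ℝ :=
  Real.exp (∑ j, θ j j * bit (x j) +
    ∑ i, ∑ j, if i < j then θ i j * bit (x i) * bit (x j) else 0)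

/-- The normalizing constant `Z_θ`. -/
noncomputable def isingConst {p : ℕ} (θ : Matrix (Fin p) (Fin p) ℝ) : ℝ :=
  ∑ x : Fin p → Bool, isingWeight θ x

/-- The Ising probability mass function `f_θ` on `{0,1}^p`. -/
noncomputable def isingDensity {p : ℕ} (θ : Matrix (Fin p) (Fin p) ℝ) (x : Fin p → Bool) : ℝ :=
  isingWeight θ x / isingConst θ

theorem isingWeight_pos {p : ℕ} (θ : Matrix (Fin p) (Fin p) ℝ) (x : Fin p → Bool) :
    0 < isingWeight θ x := Real.exp_pos _

theorem isingConst_pos {p : ℕ} (θ : Matrix (Fin p) (Fin p) ℝ) : 0 < isingConst θ :=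
  Finset.sum_pos (fun x _ => isingWeight_pos θ x) Finset.univ_nonempty

theorem sum_ofReal_isingDensity {p : ℕ} (θ : Matrix (Fin p) (Fin p) ℝ) :
    ∑ x : Fin p → Bool, ENNReal.ofReal (isingDensity θ x) = 1 := by
  have h : ∑ x : Fin p → Bool, isingDensity θ x = 1 := by
    unfold isingDensity
    rw [← Finset.sum_div]
    exact div_self (isingConst_pos θ).ne'
  have hn : ∀ x ∈ (Finset.univ : Finset (Fin p → Bool)), 0 ≤ isingDensity θ x :=
    fun x _ => (div_pos (isingWeight_pos θ x) (isingConst_pos θ)).le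
  rw [← ENNReal.ofReal_sum_of_nonneg hn, h, ENNReal.ofReal_one]

/-- The Ising distribution with mass function `f_θ`. -/
noncomputable def isingPMF {p : ℕ} (θ : Matrix (Fin p) (Fin p) ℝ) : PMF (Fin p → Bool) :=
  PMF.ofFintype (fun x => ENNReal.ofReal (isingDensity θ x)) (sum_ofReal_isingDensity θ)

/-- The law `P^{(n)}_θ` of the data matrix `Z`: its `n` rows are independent, each with mass
function `f_θ`. -/
noncomputable def dataLaw {p : ℕ} (n : ℕ) (θ : Matrix (Fin p) (Fin p) ℝ) :
    Measure (Fin n → Fin p → Bool) :=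
  Measure.pi fun _ => (isingPMF θ).toMeasure

/-! ### The quasi-likelihood, the prior and the quasi-posterior -/

/-- The quasi-likelihood
`q_{n,θ}(z) = ∏_j ∏_i exp (z_{ij} (θ_{jj} + ∑_{k≠j} θ_{kj} z_{ik})) /
(1 + exp (θ_{jj} + ∑_{k≠j} θ_{kj} z_{ik}))`. -/
noncomputable def quasiLik {p n : ℕ} (z : Fin n → Fin p → Bool)
    (θ : Matrix (Fin p) (Fin p) ℝ) : ℝ :=
  ∏ j, ∏ i,
    Real.exp (bit (z i j) * (θ j j + ∑ k ∈ Finset.univ.erase j, θ k j * bit (z i k))) /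
      (1 + Real.exp (θ j j + ∑ k ∈ Finset.univ.erase j, θ k j * bit (z i k)))

/-- The measure `μ_{p,δ}` on `ℝ^p`: Lebesgue measure in the active coordinates, a unit mass at
`0` in the others. A sparsity structure `δ ∈ {0,1}^p` is given by its set of active
coordinates. -/
noncomputable def sparseBase {p : ℕ} (δ : Finset (Fin p)) : Measure (Fin p → ℝ) :=
  Measure.pi fun k => if k ∈ δ then (volume : Measure ℝ) else Measure.dirac 0

/-- The weight `π_δ = g_{‖δ‖₀} / (p choose ‖δ‖₀)`. -/
noncomputable def structWeight {p : ℕ} (g : ℕ → ℝ) (δ : Finset (Fin p)) : ℝ :=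
  g δ.card / (p.choose δ.card : ℝ)

/-- The prior of one column,
`∑_δ π_δ (ρ/2)^{‖δ‖₀} e^{-ρ‖u‖₁} μ_{p,δ}(du)`. -/
noncomputable def columnPrior (p : ℕ) (g : ℕ → ℝ) (ρ : ℝ) : Measure (Fin p → ℝ) :=
  ∑ δ : Finset (Fin p), (sparseBase δ).withDensity fun u =>
    ENNReal.ofReal (structWeight g δ * (ρ / 2) ^ δ.card * Real.exp (-ρ * norm1 u))

/-- The Borel sigma-algebra on matrices, as the product of the Borel sigma-algebras of the
entries. -/
instance matrixMeasurableSpace (p : ℕ) : MeasurableSpace (Matrix (Fin p) (Fin p) ℝ) :=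
  inferInstanceAs (MeasurableSpace (Fin p → Fin p → ℝ))

/-- The prior on `ℝ^{p×p}`: the columns are independent with the prior `columnPrior`. A family
of columns `c` is turned into the matrix whose `(k, j)` entry is `c j k`. -/
noncomputable def matrixPrior (p : ℕ) (g : ℕ → ℝ) (ρ : ℝ) :
    Measure (Matrix (Fin p) (Fin p) ℝ) :=
  (Measure.pi fun _ : Fin p => columnPrior p g ρ).map fun c => Matrix.of fun k j => c j k

/-- The quasi-posterior distribution given the data `z`:
`A ↦ ∫_A q_{n,θ}(z) Π(dθ) / ∫ q_{n,θ}(z) Π(dθ)`. -/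
noncomputable def quasiPosterior {p n : ℕ} (g : ℕ → ℝ) (ρ : ℝ) (z : Fin n → Fin p → Bool) :
    Measure (Matrix (Fin p) (Fin p) ℝ) :=
  let μ := (matrixPrior p g ρ).withDensity fun θ => ENNReal.ofReal (quasiLik z θ)
  (μ Set.univ)⁻¹ • μ

/-- `g_0, …, g_p` is a probability distribution on `{0, …, p}` with
`(c₁ / p^{c₃}) g_{s-1} ≤ g_s ≤ (c₂ / p^{c₄}) g_{s-1}` for `1 ≤ s ≤ p`. -/
structure SparsityPrior (p : ℕ) (c₁ c₂ c₃ c₄ : ℝ) (g : ℕ → ℝ) : Prop where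
  nonneg : ∀ s ≤ p, 0 ≤ g s
  sum_eq_one : ∑ s ∈ Finset.range (p + 1), g s = 1
  lower : ∀ s, 1 ≤ s → s ≤ p → c₁ / (p : ℝ) ^ c₃ * g (s - 1) ≤ g s
  upper : ∀ s, 1 ≤ s → s ≤ p → g s ≤ c₂ / (p : ℝ) ^ c₄ * g (s - 1)

/-- The prior parameter `ρ = 24 √(n log p)`. -/
noncomputable def rho (n p : ℕ) : ℝ := 24 * Real.sqrt (n * Real.log p)

/-! ### Restricted eigenvalues of the conditional information matrices -/

/-- The second derivative `e^x / (1 + e^x)²` of `log (1 + e^x)`. -/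
noncomputable def logisticSecond (x : ℝ) : ℝ := Real.exp x / (1 + Real.exp x) ^ 2

/-- The vector `x_{(j)}`: the point `x` with its `j`-th coordinate replaced by `1`. -/
def plugOne {p : ℕ} (j : Fin p) (x : Fin p → Bool) : Fin p → ℝ :=
  fun k => if k = j then 1 else bit (x k)

/-- The matrix
`H^{(j)} = E[g''(⟨θ_{·j}, X_{(j)}⟩) X_{(j)} X_{(j)}']` for `X` with mass function `f_θ`, where
`g(x) = log (1 + e^x)`. -/
noncomputable def fisher {p : ℕ} (θ : Matrix (Fin p) (Fin p) ℝ) (j : Fin p) :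
    Matrix (Fin p) (Fin p) ℝ :=
  Matrix.of fun s t => ∑ x : Fin p → Bool, isingDensity θ x *
    (logisticSecond (column θ j ⬝ᵥ plugOne j x) * (plugOne j x s * plugOne j x t))

/-- The quotient `u' H^{(j)} u / ‖u‖₂²` as an extended non-negative number (`H^{(j)}` is positive
semidefinite, so the truncation of `ENNReal.ofReal` at zero is never active). -/
noncomputable def rayleigh {p : ℕ} (θ : Matrix (Fin p) (Fin p) ℝ) (j : Fin p)
    (u : Fin p → ℝ) : ENNReal :=
  ENNReal.ofReal ((u ⬝ᵥ (fisher θ j).mulVec u) / norm2 u ^ 2)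

/-- The smallest sparse eigenvalue `κ₂(s)`: the infimum over all `j` and all `u ≠ 0` with
`‖u‖₀ ≤ s`. -/
noncomputable def kappaSparse {p : ℕ} (θ : Matrix (Fin p) (Fin p) ℝ) (s : ℕ) : ENNReal :=
  ⨅ (j : Fin p) (u : Fin p → ℝ) (_ : u ≠ 0 ∧ nnz u ≤ s), rayleigh θ j u

/-- The restricted eigenvalue `κ₂`: the infimum over all `j` and all `u ≠ 0` with
`∑_{k : θ_{kj} = 0} |u_k| ≤ 7 ∑_{k : θ_{kj} ≠ 0} |u_k|` (and `+∞` if there are no such `u`,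
that is, if `θ = 0`). -/
noncomputable def kappaCone {p : ℕ} (θ : Matrix (Fin p) (Fin p) ℝ) : ENNReal :=
  ⨅ (j : Fin p) (u : Fin p → ℝ)
    (_ : u ≠ 0 ∧ ∑ k ∈ Finset.univ.filter (fun k => θ k j = 0), |u k| ≤
      7 * ∑ k ∈ Finset.univ.filter (fun k => θ k j ≠ 0), |u k|), rayleigh θ j u

/-! ### The sparsity levels -/

/-- `ζ_j = s_j + 4/c₄ + (2/c₄) (1 + 128/κ₂ + s_j/(64 (log p)²) + log(4e)/log p) s_j`
with `s_j = ‖θ_{·j}‖₀`; here `128/κ₂` is `0` if `κ₂ = +∞`. -/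
noncomputable def zeta {p : ℕ} (c₄ : ℝ) (θ : Matrix (Fin p) (Fin p) ℝ) (j : Fin p) : ℝ :=
  nnz (column θ j) + 4 / c₄ +
    2 / c₄ * (1 + (128 / kappaCone θ).toReal + nnz (column θ j) / (64 * Real.log p ^ 2)
      + Real.log (4 * Real.exp 1) / Real.log p) * nnz (column θ j)

/-- `s̄ = max_j ⌈s_j + ζ_j⌉`. -/
noncomputable def sBar {p : ℕ} (c₄ : ℝ) (θ : Matrix (Fin p) (Fin p) ℝ) : ℕ :=
  Finset.univ.sup fun j : Fin p => ⌈(nnz (column θ j) : ℝ) + zeta c₄ θ j⌉₊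

/-- `κ = min (κ₂, κ₂(s̄))`. -/
noncomputable def kappaMin {p : ℕ} (c₄ : ℝ) (θ : Matrix (Fin p) (Fin p) ℝ) : ENNReal :=
  min (kappaCone θ) (kappaSparse θ (sBar c₄ θ))

end IsingQuasi

namespace IsingQuasi

/-! ### The logistic function -/

/-! The quasi-likelihood is a product of logistic-regression likelihoods, one per column, and the
prior is a product over columns. Hence the quasi-posterior is a product measure, and it suffices to
show that each column leaves its ball with probability at most `1/p²` on an event of probability at
least `1 - 4/p`. A union over columns then gives `1/p + 4/p`.

Fix a column with true value `a` and log-likelihood `L`, and put `d = u - a`, `r = √(log p / n)`. On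
the event `Regular` the scores are at most `ρ/4`, and the empirical information matrix is entrywise
close to its mean. This event is controlled by Hoeffding's inequality, since the score has mean zero
under the Ising model. On it, `L u - L a` is at most `(ρ/4)‖d‖₁ - Q(d)/(2(1+‖d‖₁))`, with `Q` the
empirical information form. The denominator comes from a global logistic bound
(`logistic_bregman_ge`), so `d` need not be small beforehand.

The core is `exists_colLogLik_bound`: outside the ball, `L u - ρ‖u‖₁` lies below `L a - ρ‖a‖₁ - C s̄
log p - (ρ/4)‖d‖₁`, for every `u`, sparse or not. The remaining Laplace kernel around `a` is
integrable on each coordinate subspace, at the price of a factor 4 per active coordinate, which the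
decay of `g` absorbs. Thus no separate bound on the posterior support and no tests are needed. The
normalizing constant is bounded below on a small box around `a` in its own model, at a cost of order
`s̄ log p`, which `C` is chosen to exceed.

If the core inequality fails at `d`, split `‖d‖₁` into its mass on and off the support of `a`. When
the mass off the support is large, the penalty alone forces `‖d‖₁ = O(s̄ r)`; otherwise the
restricted eigenvalue on the cone does. In both cases `Q(d)/n = O(s̄ r²)`. Finally, Maurey's
sampling argument (`sparse_eigenvalue_transfer`) extends the sparse eigenvalue bound to all vectors
with error `‖d‖₁²/s̄ = O(s̄ r²)`, which bounds `‖d‖₂`; `exists_radius` does this arithmetic. -/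

theorem logistic_remainder_pos_bound {q h : ℝ} (hq0 : 0 ≤ q) (hq1 : q ≤ 1) (hh : 0 ≤ h) :
    q * (1 - q) * (h ^ 2 / (2 * (1 + h))) ≤ Real.log (1 - q + q * Real.exp h) - q * h := by
  have hpos : ∀ x : ℝ, 0 < 1 - q + q * Real.exp x := by
    intro x
    have := Real.exp_pos x
    rcases hq0.eq_or_lt with h0 | h0
    · rw [← h0]; norm_num
    · have := mul_pos h0 this; linarith
  -- The difference of the two sides vanishes at 0, so a nonnegative derivative on the half-line
  -- suffices.
  let F : ℝ → ℝ := fun x =>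
    Real.log (1 - q + q * Real.exp x) - q * x - q * (1 - q) * (x ^ 2 / (2 * (1 + x)))
  let F' : ℝ → ℝ := fun x =>
    q * Real.exp x / (1 - q + q * Real.exp x) - q -
      q * (1 - q) * ((2 * x * (2 * (1 + x)) - x ^ 2 * 2) / (2 * (1 + x)) ^ 2)
  have hderiv : ∀ x, 0 ≤ x → HasDerivAt F (F' x) x := by
    intro x hx
    have h1 : HasDerivAt (fun x => Real.log (1 - q + q * Real.exp x))
        (q * Real.exp x / (1 - q + q * Real.exp x)) x :=
      (((Real.hasDerivAt_exp x).const_mul q).const_add (1 - q)).log (hpos x).ne'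
    have h2 : HasDerivAt (fun x : ℝ => x ^ 2 / (2 * (1 + x)))
        ((2 * x * (2 * (1 + x)) - x ^ 2 * 2) / (2 * (1 + x)) ^ 2) x := by
      have ha : HasDerivAt (fun x : ℝ => x ^ 2) (2 * x) x := by simpa using hasDerivAt_pow 2 x
      have hb : HasDerivAt (fun x : ℝ => 2 * (1 + x)) 2 x := by
        simpa using ((hasDerivAt_id x).const_add 1).const_mul 2
      exact ha.div hb (by positivity)
    have h3 : HasDerivAt (fun x : ℝ => q * x) q x := by
      simpa using (hasDerivAt_id x).const_mul q
    exact (h1.sub h3).sub (h2.const_mul _)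
  have hnonneg : ∀ x, 0 ≤ x → 0 ≤ F' x := by
    intro x hx
    have he := Real.add_one_le_exp x
    have hep := Real.exp_pos x
    have e1 : q * Real.exp x / (1 - q + q * Real.exp x) - q =
        q * (1 - q) * ((Real.exp x - 1) / (1 - q + q * Real.exp x)) := by
      have := (hpos x).ne'
      field_simp
      ring
    -- The denominator on the right is at most `e^x`, and `1 - e^{-x} ≥ x/(1+x)`; by `e3` the
    -- derivative of `x²/(2(1+x))` is no larger than `x/(1+x)`.
    have e2 : (x / (1 + x)) ≤ (Real.exp x - 1) / (1 - q + q * Real.exp x) := by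
      rw [div_le_div_iff₀ (by linarith) (hpos x)]
      have : 1 - q + q * Real.exp x ≤ Real.exp x := by nlinarith
      nlinarith
    have e3 : (2 * x * (2 * (1 + x)) - x ^ 2 * 2) / (2 * (1 + x)) ^ 2 ≤ x / (1 + x) := by
      rw [div_le_div_iff₀ (by positivity) (by positivity)]
      have h4 : 0 ≤ 2 * x ^ 2 * (1 + x) := by positivity
      nlinarith [mul_nonneg hx h4]
    have hq : 0 ≤ q * (1 - q) := mul_nonneg hq0 (by linarith)
    change 0 ≤ q * Real.exp x / (1 - q + q * Real.exp x) - q -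
      q * (1 - q) * ((2 * x * (2 * (1 + x)) - x ^ 2 * 2) / (2 * (1 + x)) ^ 2)
    rw [e1, ← mul_sub]
    exact mul_nonneg hq (by linarith)
  have hmono : MonotoneOn F (Set.Ici 0) := by
    apply monotoneOn_of_deriv_nonneg (convex_Ici 0)
    · exact fun x hx => (hderiv x hx).continuousAt.continuousWithinAt
    · intro x hx
      rw [interior_Ici] at hx
      exact (hderiv x (le_of_lt hx)).differentiableAt.differentiableWithinAt
    · intro x hx
      rw [interior_Ici] at hx
      rw [(hderiv x (le_of_lt hx)).deriv]
      exact hnonneg x (le_of_lt hx)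
  have := hmono (Set.mem_Ici.2 le_rfl) (Set.mem_Ici.2 hh) hh
  have hF0 : F 0 = 0 := by simp [F]
  rw [hF0] at this
  simp only [F] at this
  linarith

/-- Exchanging success and failure, `(q, h) ↦ (1-q, -h)`, preserves the expression and reduces to `h
≥ 0`. -/
theorem logistic_remainder_bound {q : ℝ} (hq0 : 0 ≤ q) (hq1 : q ≤ 1) (h : ℝ) :
    q * (1 - q) * (h ^ 2 / (2 * (1 + |h|))) ≤ Real.log (1 - q + q * Real.exp h) - q * h := by
  rcases le_total 0 h with hh | hh
  · rw [abs_of_nonneg hh]; exact logistic_remainder_pos_bound hq0 hq1 hh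
  · have h1 := logistic_remainder_pos_bound (q := 1 - q) (by linarith) (by linarith)
      (neg_nonneg.2 hh)
    have hep := Real.exp_pos h
    have hpos : 0 < 1 - (1 - q) + (1 - q) * Real.exp (-h) := by
      have := Real.exp_pos (-h)
      rcases hq0.eq_or_lt with h0 | h0
      · rw [← h0]; linarith
      · have : 0 ≤ (1 - q) * Real.exp (-h) := mul_nonneg (by linarith) this.le
        linarith
    have h2 : 1 - q + q * Real.exp h = (1 - (1 - q) + (1 - q) * Real.exp (-h)) * Real.exp h := by
      have : Real.exp (-h) * Real.exp h = 1 := by rw [← Real.exp_add]; simp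
      linear_combination (-(1 - q)) * this
    rw [h2, Real.log_mul hpos.ne' hep.ne', Real.log_exp, abs_of_nonpos hh]
    have e : q * (1 - q) * (h ^ 2 / (2 * (1 + -h))) =
        (1 - q) * (1 - (1 - q)) * ((-h) ^ 2 / (2 * (1 + -h))) := by rw [neg_sq]; ring
    rw [e]
    linarith

/-- The logistic function `e^x / (1 + e^x)`, the derivative of `log (1 + e^x)`. -/
noncomputable def sigmoid (x : ℝ) : ℝ := Real.exp x / (1 + Real.exp x)

theorem sigmoid_nonneg (x : ℝ) : 0 ≤ sigmoid x := by unfold sigmoid; positivity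

theorem sigmoid_le_one (x : ℝ) : sigmoid x ≤ 1 := by
  unfold sigmoid
  rw [div_le_one (by positivity)]
  linarith

theorem logisticSecond_eq (x : ℝ) : logisticSecond x = sigmoid x * (1 - sigmoid x) := by
  unfold logisticSecond sigmoid
  have : 1 + Real.exp x ≠ 0 := by positivity
  field_simp
  ring

theorem logisticSecond_nonneg (x : ℝ) : 0 ≤ logisticSecond x := by
  unfold logisticSecond; positivity

theorem logisticSecond_le (x : ℝ) : logisticSecond x ≤ 1 / 4 := by
  rw [logisticSecond_eq]; nlinarith [sq_nonneg (sigmoid x - 1 / 2)]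

/-- The increment is the log moment generating function of a Bernoulli variable with success
probability `sigmoid a`; this is how the bounds in `q` enter. -/
theorem log_one_add_exp_add (a h : ℝ) :
    Real.log (1 + Real.exp (a + h)) =
      Real.log (1 + Real.exp a) + Real.log (1 - sigmoid a + sigmoid a * Real.exp h) := by
  have h0 : 0 < 1 + Real.exp a := by positivity
  have h1 : 1 - sigmoid a + sigmoid a * Real.exp h =
      (1 + Real.exp (a + h)) / (1 + Real.exp a) := by
    unfold sigmoid
    rw [Real.exp_add]
    field_simp
    ring
  rw [h1, Real.log_div (by positivity) h0.ne']
  ring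

/-- Quadratic for small `h`, linear for large `h`, and valid without any restriction on `h`. -/
theorem logistic_bregman_ge (a h : ℝ) :
    logisticSecond a * (h ^ 2 / (2 * (1 + |h|))) ≤
      Real.log (1 + Real.exp (a + h)) - Real.log (1 + Real.exp a) - sigmoid a * h := by
  rw [log_one_add_exp_add, logisticSecond_eq]
  have := logistic_remainder_bound (sigmoid_nonneg a) (sigmoid_le_one a) h
  linarith

theorem logistic_bregman_le (a h : ℝ) (hh : |h| ≤ 1) :
    Real.log (1 + Real.exp (a + h)) - Real.log (1 + Real.exp a) - sigmoid a * h ≤ h ^ 2 := by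
  rw [log_one_add_exp_add]
  have h0 := sigmoid_nonneg a
  have h1 := sigmoid_le_one a
  have h2 := (abs_le.1 (Real.abs_exp_sub_one_sub_id_le hh)).2
  have h3 : 0 < 1 - sigmoid a + sigmoid a * Real.exp h := by
    have : 0 < 1 + Real.exp a := by positivity
    have e : 1 - sigmoid a + sigmoid a * Real.exp h =
        (1 + Real.exp (a + h)) / (1 + Real.exp a) := by
      unfold sigmoid
      rw [Real.exp_add]
      field_simp
      ring
    rw [e]; positivity
  have h4 := Real.log_le_sub_one_of_pos h3
  nlinarith [sq_nonneg h]

/-! ### Sparse approximation of quadratic forms -/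

theorem nnz_add_single_le {p : ℕ} (y : Fin p → ℝ) (k : Fin p) (c : ℝ) :
    nnz (y + Pi.single k c) ≤ nnz y + 1 := by
  unfold nnz
  have : (Finset.univ.filter fun i => (y + Pi.single k c : Fin p → ℝ) i ≠ 0) ⊆
      insert k (Finset.univ.filter fun i => y i ≠ 0) := by
    intro i hi
    simp only [Finset.mem_filter, Finset.mem_univ, true_and, Finset.mem_insert] at hi ⊢
    by_cases hik : i = k
    · exact Or.inl hik
    · right
      simpa [Pi.single_eq_of_ne hik] using hi
  exact (Finset.card_le_card this).trans (Finset.card_insert_le _ _)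

/-- Derandomized sampling of `m` atoms of a convex combination `u` of multiples of basis
vectors: the value of a quadratic form at the sum is at most its expectation. -/
theorem exists_sparse_le {p : ℕ} (B : (Fin p → ℝ) →ₗ[ℝ] (Fin p → ℝ) →ₗ[ℝ] ℝ)
    (hB : ∀ x y, B x y = B y x) (w c : Fin p → ℝ) (hw : ∀ k, 0 ≤ w k) (hw1 : ∑ k, w k = 1)
    (u : Fin p → ℝ) (hu : ∑ k, w k • (Pi.single k (c k) : Fin p → ℝ) = u) (m : ℕ) :
    ∀ y : Fin p → ℝ, ∃ x : Fin p → ℝ, nnz x ≤ nnz y + m ∧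
      B x x ≤ B y y + 2 * m * B y u
        + m * ∑ k, w k * B (Pi.single k (c k)) (Pi.single k (c k)) + m * (m - 1) * B u u := by
  set e : Fin p → Fin p → ℝ := fun k => Pi.single k (c k) with he
  set V : ℝ := ∑ k, w k * B (e k) (e k) with hV
  have lin : ∀ z, ∑ k, w k * B z (e k) = B z u := by
    intro z
    rw [← hu, map_sum]
    simp [he]
  induction m with
  | zero => intro y; exact ⟨y, by simp, by simp⟩
  | succ m ih =>
    intro y
    -- `f k` is the part of the induction bound that depends on the next atom when that atom is `e
    -- k`. Its `w`-average is the corresponding part of the bound for `m + 1`, so some `k` does at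
    -- least as well.
    let f : Fin p → ℝ := fun k => B (y + e k) (y + e k) + 2 * m * B (y + e k) u
    have hf : ∑ k, w k * f k =
        B y y + 2 * (m + 1) * B y u + V + 2 * m * B u u := by
      have h1 : ∀ k, w k * f k = w k * (B y y + 2 * m * B y u) + 2 * (w k * B y (e k))
          + w k * B (e k) (e k) + 2 * m * (w k * B u (e k)) := by
        intro k
        simp only [f, map_add, LinearMap.add_apply]
        rw [hB (e k) y, hB (e k) u]
        ring
      simp_rw [h1, Finset.sum_add_distrib, ← Finset.mul_sum, ← Finset.sum_mul, lin, hw1]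
      ring
    obtain ⟨k, hk⟩ : ∃ k, f k ≤ ∑ k, w k * f k := by
      by_contra hcon
      push Not at hcon
      have hlt : ∑ k, w k * (∑ k, w k * f k) < ∑ k, w k * f k := by
        obtain ⟨k0, hk0⟩ : ∃ k, 0 < w k := by
          by_contra hc
          push Not at hc
          have : ∑ k, w k ≤ 0 := Finset.sum_nonpos fun k _ => hc k
          linarith
        exact Finset.sum_lt_sum (fun k _ => mul_le_mul_of_nonneg_left (hcon k).le (hw k))
          ⟨k0, Finset.mem_univ _, mul_lt_mul_of_pos_left (hcon k0) hk0⟩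
      rw [← Finset.sum_mul, hw1, one_mul] at hlt
      exact lt_irrefl _ hlt
    obtain ⟨x, hx, hx'⟩ := ih (y + e k)
    refine ⟨x, hx.trans ?_, hx'.trans ?_⟩
    · have := nnz_add_single_le y k (c k)
      simp only [he]; omega
    · simp only [f] at hk hf
      rw [hf] at hk
      push_cast
      nlinarith

theorem nnz_zero {p : ℕ} : nnz (0 : Fin p → ℝ) = 0 := by simp [nnz]

theorem norm2_sq {p : ℕ} (u : Fin p → ℝ) : norm2 u ^ 2 = ∑ k, u k ^ 2 :=
  Real.sq_sqrt (Finset.sum_nonneg fun _ _ => sq_nonneg _)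

theorem norm1_nonneg {p : ℕ} (u : Fin p → ℝ) : 0 ≤ norm1 u :=
  Finset.sum_nonneg fun _ _ => abs_nonneg _

theorem norm2_nonneg {p : ℕ} (u : Fin p → ℝ) : 0 ≤ norm2 u := Real.sqrt_nonneg _

theorem norm2_sq_le_norm1_sq {p : ℕ} (u : Fin p → ℝ) : norm2 u ^ 2 ≤ norm1 u ^ 2 := by
  rw [norm2_sq, norm1]
  have := Finset.sum_sq_le_sq_sum_of_nonneg (s := Finset.univ) (f := fun k => |u k|)
    (fun k _ => abs_nonneg _)
  simpa using this

/-- A lower bound of a positive semidefinite quadratic form on sparse vectors extends to all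
vectors, with an error of order `‖u‖₁² / m`. -/
theorem sparse_eigenvalue_transfer {p : ℕ} (H : Matrix (Fin p) (Fin p) ℝ) (hH : H.IsSymm)
    (hdiag : ∀ k, H k k ≤ 1 / 4) (hpsd : ∀ u, 0 ≤ u ⬝ᵥ H.mulVec u) (κ : ℝ) (hκ : 0 ≤ κ)
    (hκ' : κ ≤ 1 / 4) (m : ℕ) (hm : 1 ≤ m)
    (hs : ∀ x : Fin p → ℝ, nnz x ≤ m → κ * norm2 x ^ 2 ≤ x ⬝ᵥ H.mulVec x) (u : Fin p → ℝ) :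
    κ * norm2 u ^ 2 ≤ u ⬝ᵥ H.mulVec u + norm1 u ^ 2 / (2 * m) := by
  -- The sampling bound divides by `m - 1`, so `m = 1` is separate; there `κ ≤ 1/4` and `‖u‖₂ ≤
  -- ‖u‖₁` suffice.
  rcases hm.eq_or_lt with rfl | hm2
  · have h1 := norm2_sq_le_norm1_sq u
    have h2 := hpsd u
    have h3 : 0 ≤ norm2 u ^ 2 := sq_nonneg _
    push_cast
    nlinarith
  rcases (norm1_nonneg u).eq_or_lt with h0 | hL
  · have h1 := norm2_sq_le_norm1_sq u
    rw [← h0] at h1 ⊢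
    have h2 := hpsd u
    have h3 : 0 ≤ norm2 u ^ 2 := sq_nonneg _
    have h4 : norm2 u ^ 2 = 0 := by nlinarith
    rw [h4]; simpa using h2
  set L := norm1 u with hLdef
  -- The form of `H - κ` is nonnegative on `m`-sparse vectors. Sampling `m` atoms `±L e_k` with
  -- weights `|u_k|/L`, whose mean is `u`, gives a sparse `x` with `0 ≤ B x x ≤ m L²/4 + m(m-1) B u
  -- u`.
  let G : Matrix (Fin p) (Fin p) ℝ := H - κ • (1 : Matrix (Fin p) (Fin p) ℝ)
  have hGq : ∀ x, x ⬝ᵥ G.mulVec x = x ⬝ᵥ H.mulVec x - κ * norm2 x ^ 2 := by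
    intro x
    simp only [G, Matrix.sub_mulVec, Matrix.smul_mulVec, Matrix.one_mulVec, dotProduct_sub,
      dotProduct_smul, norm2_sq, smul_eq_mul]
    simp [dotProduct, sq]
  have hGs : G.IsSymm := by
    simp only [G]
    exact hH.sub (Matrix.isSymm_one.smul κ)
  let B : (Fin p → ℝ) →ₗ[ℝ] (Fin p → ℝ) →ₗ[ℝ] ℝ := Matrix.toLinearMap₂' ℝ G
  have hBapp : ∀ x y, B x y = x ⬝ᵥ G.mulVec y := fun x y => Matrix.toLinearMap₂'_apply' G x y
  have hBs : ∀ x y, B x y = B y x := by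
    intro x y
    rw [hBapp, hBapp, Matrix.dotProduct_mulVec, ← Matrix.mulVec_transpose, hGs.eq, dotProduct_comm]
  obtain ⟨x, hx, hx'⟩ := exists_sparse_le B hBs (fun k => |u k| / L)
    (fun k => SignType.sign (u k) * L) (fun k => by positivity)
    (by rw [← Finset.sum_div]; exact div_self hL.ne') u
    (by
      ext i
      rw [Finset.sum_apply, Finset.sum_eq_single i]
      · simp only [Pi.smul_apply, Pi.single_eq_same, smul_eq_mul]
        rw [div_mul_eq_mul_div, ← mul_assoc, mul_div_assoc, div_self hL.ne', mul_one, mul_comm]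
        exact sign_mul_abs (u i)
      · intro b _ hb
        simp [Pi.single_eq_of_ne hb.symm]
      · simp) m 0
  rw [nnz_zero, zero_add] at hx
  have h1 := hs x hx
  have h2 : 0 ≤ B x x := by rw [hBapp, hGq]; linarith
  have h3 : ∀ k, B (Pi.single k ((SignType.sign (u k) : ℝ) * L))
      (Pi.single k ((SignType.sign (u k) : ℝ) * L)) ≤ L ^ 2 / 4 := by
    intro k
    rw [hBapp]
    have e : (Pi.single k ((SignType.sign (u k) : ℝ) * L) : Fin p → ℝ) ⬝ᵥ
        G.mulVec (Pi.single k ((SignType.sign (u k) : ℝ) * L)) =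
        G k k * ((SignType.sign (u k) : ℝ) * L) ^ 2 := by
      rw [single_dotProduct, Matrix.mulVec_single]
      simp
      ring
    rw [e]
    have hG : G k k ≤ 1 / 4 := by simp [G]; linarith [hdiag k]
    have hsg : ((SignType.sign (u k) : ℝ) * L) ^ 2 ≤ L ^ 2 := by
      rcases lt_trichotomy (u k) 0 with h | h | h
      · simp [h]
      · simp [h]; positivity
      · simp [h]
    nlinarith [sq_nonneg ((SignType.sign (u k) : ℝ) * L), sq_nonneg L]
  have h4 : ∑ k, |u k| / L * B (Pi.single k ((SignType.sign (u k) : ℝ) * L))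
      (Pi.single k ((SignType.sign (u k) : ℝ) * L)) ≤ L ^ 2 / 4 := by
    calc _ ≤ ∑ k, |u k| / L * (L ^ 2 / 4) :=
          Finset.sum_le_sum fun k _ => mul_le_mul_of_nonneg_left (h3 k) (by positivity)
      _ = L ^ 2 / 4 := by
          rw [← Finset.sum_mul, ← Finset.sum_div]
          change norm1 u / L * _ = _
          rw [div_self hL.ne', one_mul]
  have hu := hGq u
  rw [← hBapp] at hu
  simp only [map_zero, LinearMap.zero_apply, mul_zero, zero_add] at hx'
  have hm' : (2 : ℝ) ≤ m := by exact_mod_cast hm2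
  have h5 : 0 ≤ m * (L ^ 2 / 4 + (m - 1) * B u u) := by nlinarith
  have h6 : 0 ≤ L ^ 2 / 4 + (m - 1) * B u u := by
    by_contra hc
    push Not at hc
    nlinarith
  -- Uses `m - 1 ≥ m/2`, valid for `m ≥ 2`.
  have h7 : -(L ^ 2 / (2 * m)) ≤ B u u := by
    rw [neg_le, le_div_iff₀ (by positivity)]
    by_cases hb : 0 ≤ B u u
    · nlinarith [sq_nonneg L]
    · push Not at hb
      nlinarith
  linarith

/-! ### From a lower bound of the penalized log-likelihood ratio to a Euclidean radius -/

set_option maxHeartbeats 800000 in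
-- In the application `s` is the support size, `sb` is `s̄`, `r = √(log p / n)`, `k` and `ks` are
-- the minimal and the sparse eigenvalue, `a` and `b` the `ℓ¹` masses of the deviation on and off
-- the support, `q` its empirical information form per observation, and `v` its Euclidean norm. With
-- `w = sb * r`, both cases `b ≤ 7a` and `b ≥ 7a` give `a + b = O(w)` and `q = O(sb * r²)`. The
-- hypothesis `s ≤ c * sb * kc` keeps the constants free of the eigenvalues.
theorem exists_radius (c C : ℝ) (hc : 0 < c) (hC : 1 ≤ C) :
    ∃ M : ℝ, 2 < M ∧ ∀ s sb r k ks a b q v : ℝ,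
      0 < k → k ≤ ks → ks ≤ 1 / 4 → 0 < r → 1 ≤ sb → 0 ≤ s → 2 * s ≤ sb →
      sb * r ≤ k / 1296 → 0 ≤ a → 0 ≤ b → 0 ≤ v → a ^ 2 ≤ s * v ^ 2 → 0 ≤ q →
      (b ≤ 7 * a → 0 < a → ∃ kc, k ≤ kc ∧ s ≤ c * sb * kc ∧
        kc * v ^ 2 ≤ q + k * (a + b) ^ 2 / (64 * sb)) →
      ks * v ^ 2 ≤ q + (a + b) ^ 2 / sb →
      -(C * sb * r ^ 2) ≤ 36 * r * a - 12 * r * b - q / (2 * (1 + (a + b))) →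
      v ≤ M / ks * (Real.sqrt sb * r) := by
  obtain ⟨C1, hC1⟩ : ∃ x : ℝ, x = 1 + C := ⟨_, rfl⟩
  obtain ⟨K, hK⟩ : ∃ x : ℝ, x = 4 * c * (1 + 8 * C1) := ⟨_, rfl⟩
  obtain ⟨K', hK'⟩ : ∃ x : ℝ, x = 36 * K + K * C + 1 := ⟨_, rfl⟩
  obtain ⟨D1, hD1⟩ : ∃ x : ℝ, x = 2 * (1 + C) * C + C ^ 2 := ⟨_, rfl⟩
  obtain ⟨D2, hD2⟩ : ∃ x : ℝ, x = 2 * (1 + 8 * C1) * (36 * K' + C) + 64 * K' ^ 2 := ⟨_, rfl⟩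
  have hC1pos : 0 < C1 := by rw [hC1]; positivity
  have hKpos : 0 < K := by rw [hK]; positivity
  have hK'pos : 0 < K' := by rw [hK']; positivity
  have hD1pos : 0 < D1 := by rw [hD1]; positivity
  have hD2pos : 0 < D2 := by rw [hD2]; positivity
  refine ⟨D1 + D2 + 3, by linarith, ?_⟩
  intro s sb r k ks a b q v hk hkks hks hr hsb hs hssb hsr ha hb hv hav hq hcone htr hmain
  have hks0 : 0 < ks := hk.trans_le hkks
  have hsb0 : 0 < sb := by linarith
  obtain ⟨w, hw⟩ : ∃ x : ℝ, x = sb * r := ⟨_, rfl⟩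
  rw [← hw] at hsr
  have hw0 : 0 < w := by rw [hw]; exact mul_pos hsb0 hr
  have hwr : w * r = sb * r ^ 2 := by rw [hw]; ring
  have hw1 : w ≤ 1 := by linarith
  suffices hmainbound : ks * v ^ 2 ≤ (D1 + D2) * (sb * r ^ 2) by
    rw [div_mul_eq_mul_div, le_div_iff₀ hks0]
    refine le_of_sq_le_sq ?_ (by positivity)
    rw [mul_pow, mul_pow, mul_pow, Real.sq_sqrt hsb0.le]
    have h1 : ks * (ks * v ^ 2) ≤ 1 / 4 * ((D1 + D2) * (sb * r ^ 2)) :=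
      mul_le_mul hks hmainbound (by positivity) (by norm_num)
    have h2 : 0 < sb * r ^ 2 := by positivity
    have h3 : 1 / 4 * (D1 + D2) ≤ (D1 + D2 + 3) ^ 2 := by nlinarith
    linarith [mul_le_mul_of_nonneg_right h3 h2.le]
  have hqb : q ≤ 2 * (1 + (a + b)) * (36 * r * a - 12 * r * b + C * sb * r ^ 2) := by
    have : q / (2 * (1 + (a + b))) ≤ 36 * r * a - 12 * r * b + C * sb * r ^ 2 := by linarith
    rw [div_le_iff₀ (by positivity)] at this
    linarith
  by_cases hcase : b ≤ 7 * a ∧ 0 < a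
  · obtain ⟨hba, ha0⟩ := hcase
    obtain ⟨kc, hkkc, hskc, hkcv⟩ := hcone hba ha0
    have hkc0 : 0 < kc := hk.trans_le hkkc
    have hab : (a + b) ^ 2 ≤ 64 * a ^ 2 := by
      have := pow_le_pow_left₀ (add_nonneg ha hb) (by linarith : a + b ≤ 8 * a) 2
      linarith
    have h1 : kc * v ^ 2 ≤ 2 * q := by
      have h2 : k * (a + b) ^ 2 / (64 * sb) ≤ k * v ^ 2 / 2 := by
        rw [div_le_div_iff₀ (by positivity) (by norm_num)]
        have : (a + b) ^ 2 ≤ 32 * sb * v ^ 2 := by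
          linarith [mul_le_mul_of_nonneg_right hssb (sq_nonneg v)]
        linarith [mul_le_mul_of_nonneg_left this hk.le]
      linarith [mul_le_mul_of_nonneg_right hkkc (sq_nonneg v)]
    have hq2 : q ≤ 2 * (1 + 8 * a) * (36 * r * a + C * sb * r ^ 2) := by
      have h36 : 0 ≤ 36 * r * a + C * sb * r ^ 2 := by positivity
      refine hqb.trans ?_
      calc _ ≤ 2 * (1 + (a + b)) * (36 * r * a + C * sb * r ^ 2) := by
            apply mul_le_mul_of_nonneg_left _ (by positivity)
            linarith [mul_nonneg hr.le hb]
        _ ≤ _ := by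
            apply mul_le_mul_of_nonneg_right _ h36
            linarith
    have hI : kc * a ^ 2 ≤ 2 * s * q := by
      calc kc * a ^ 2 ≤ kc * (s * v ^ 2) := mul_le_mul_of_nonneg_left hav hkc0.le
        _ = s * (kc * v ^ 2) := by ring
        _ ≤ s * (2 * q) := mul_le_mul_of_nonneg_left h1 hs
        _ = _ := by ring
    have hI2 : kc * a ^ 2 ≤ 4 * s * (1 + 8 * a) * (36 * r * a + C * sb * r ^ 2) := by
      calc kc * a ^ 2 ≤ 2 * s * q := hI
        _ ≤ 2 * s * (2 * (1 + 8 * a) * (36 * r * a + C * sb * r ^ 2)) :=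
            mul_le_mul_of_nonneg_left hq2 (by positivity)
        _ = _ := by ring
    have hsrw : s * r ≤ kc / 2592 := by linarith [mul_le_mul_of_nonneg_right hssb hr.le]
    -- A first crude bound, needed because the factor `1 + 8a` makes both sides of `hI2` quadratic
    -- in `a`. For `a > 1` it is at most `9a`, one power of `a` cancels, and since `4 · 9 · 36 =
    -- 1296` the bound `s * r ≤ kc / 2592` makes the linear term at most half of the left side.
    have haC : a ≤ C1 := by
      by_contra hcon
      push Not at hcon
      have ha1 : 1 < a := by linarith
      have hX : 0 ≤ s * (36 * r * a + C * sb * r ^ 2) := by positivity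
      have h3 : kc * a ^ 2 ≤ 36 * (s * (36 * r * a + C * sb * r ^ 2)) * a := by
        calc kc * a ^ 2 ≤ 4 * (1 + 8 * a) * (s * (36 * r * a + C * sb * r ^ 2)) := by linarith
          _ ≤ 4 * (9 * a) * (s * (36 * r * a + C * sb * r ^ 2)) := by
            apply mul_le_mul_of_nonneg_right _ hX
            linarith
          _ = _ := by ring
      have h4 : kc * a ≤ 36 * (s * (36 * r * a + C * sb * r ^ 2)) := by
        have : kc * a * a ≤ 36 * (s * (36 * r * a + C * sb * r ^ 2)) * a := by linarith
        exact le_of_mul_le_mul_right this ha0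
      have h5 : 36 * (s * (36 * r * a + C * sb * r ^ 2)) =
          1296 * (s * r) * a + 36 * C * (s * r) * w := by rw [hw]; ring
      have h6 : 1296 * (s * r) * a ≤ kc / 2 * a := by
        apply mul_le_mul_of_nonneg_right _ ha
        linarith
      have h7 : 36 * C * (s * r) * w ≤ 36 * C * (kc / 2592) * 1 := by
        apply mul_le_mul _ hw1 hw0.le (by positivity)
        exact mul_le_mul_of_nonneg_left hsrw (by positivity)
      have h8 : kc * a ≤ kc * C := by linarith [mul_pos hkc0 (by linarith : 0 < C)]
      have := le_of_mul_le_mul_left h8 hkc0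
      linarith
    -- Now `1 + 8a` is bounded and `s ≤ c * sb * kc` lets `kc` cancel; the resulting quadratic
    -- inequality in `a` forces `a ≤ K' * w`.
    have hJ : a ^ 2 ≤ K * (36 * w * a + C * w ^ 2) := by
      have h36 : 0 ≤ 36 * r * a + C * sb * r ^ 2 := by positivity
      have h9 : kc * a ^ 2 ≤ kc * (K * (36 * w * a + C * w ^ 2)) := by
        calc kc * a ^ 2 ≤ 4 * s * (1 + 8 * a) * (36 * r * a + C * sb * r ^ 2) := hI2
          _ ≤ 4 * (c * sb * kc) * (1 + 8 * C1) * (36 * r * a + C * sb * r ^ 2) := by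
            apply mul_le_mul_of_nonneg_right _ h36
            apply mul_le_mul _ (by linarith) (by positivity) (by positivity)
            linarith
          _ = _ := by rw [hw, hK]; ring
      exact le_of_mul_le_mul_left h9 hkc0
    have haw : a ≤ K' * w := by
      by_contra hcon
      push Not at hcon
      have h10 : w < a := by
        have : 0 < K * C := by positivity
        have h1K' : 1 ≤ K' := by rw [hK']; linarith
        exact (le_mul_of_one_le_left hw0.le h1K').trans_lt hcon
      have h11 : K * C * w ^ 2 ≤ K * C * w * a := by
        have : 0 ≤ K * C * w := by positivity
        have := mul_le_mul_of_nonneg_left h10.le this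
        linarith
      have h12 : a * a ≤ (36 * K * w + K * C * w) * a := by linarith
      have h13 := le_of_mul_le_mul_right h12 ha0
      rw [hK'] at hcon
      linarith
    have hq3 : q ≤ 2 * (1 + 8 * C1) * (36 * K' + C) * (sb * r ^ 2) := by
      calc q ≤ 2 * (1 + 8 * a) * (36 * r * a + C * sb * r ^ 2) := hq2
        _ ≤ 2 * (1 + 8 * C1) * (36 * r * (K' * w) + C * sb * r ^ 2) := by
          apply mul_le_mul _ _ (by positivity) (by positivity)
          · linarith
          · have : 36 * r * a ≤ 36 * r * (K' * w) := mul_le_mul_of_nonneg_left haw (by positivity)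
            linarith
        _ = _ := by rw [hw]; ring
    have hL : (a + b) ^ 2 / sb ≤ 64 * K' ^ 2 * (sb * r ^ 2) := by
      rw [div_le_iff₀ hsb0]
      calc (a + b) ^ 2 ≤ 64 * a ^ 2 := hab
        _ ≤ 64 * (K' * w) ^ 2 := by
          have := pow_le_pow_left₀ ha haw 2
          linarith
        _ = _ := by rw [hw]; ring
    have : 0 ≤ D1 * (sb * r ^ 2) := by positivity
    calc ks * v ^ 2 ≤ q + (a + b) ^ 2 / sb := htr
      _ ≤ D2 * (sb * r ^ 2) := by rw [hD2]; linarith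
      _ ≤ _ := by linarith
  · have hb7 : 7 * a ≤ b := by
      by_contra hcon
      push Not at hcon
      apply hcase
      refine ⟨hcon.le, ?_⟩
      by_contra h0
      linarith
    -- The value 7 is what makes the penalty dominate: `36a + 6a ≤ 6b`. No eigenvalue is needed to
    -- bound `a + b` here.
    have hlin : 36 * r * a - 12 * r * b ≤ -(6 * r * (a + b)) := by
      linarith [mul_le_mul_of_nonneg_left hb7 hr.le]
    have hqd : 0 ≤ q / (2 * (1 + (a + b))) := by positivity
    have hLw : a + b ≤ C * w := by
      have : 6 * r * (a + b) ≤ r * (C * w) := by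
        have e : r * (C * w) = C * sb * r ^ 2 := by rw [hw]; ring
        linarith
      have h2 : r * (6 * (a + b)) ≤ r * (C * w) := by linarith
      have := le_of_mul_le_mul_left h2 hr
      linarith
    have hLC : a + b ≤ C := hLw.trans (mul_le_of_le_one_right (by linarith) hw1)
    have hq4 : q ≤ 2 * (1 + C) * C * (sb * r ^ 2) := by
      calc q ≤ 2 * (1 + (a + b)) * (36 * r * a - 12 * r * b + C * sb * r ^ 2) := hqb
        _ ≤ 2 * (1 + (a + b)) * (C * sb * r ^ 2) := by
          apply mul_le_mul_of_nonneg_left _ (by positivity)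
          linarith [mul_nonneg hr.le (add_nonneg ha hb)]
        _ ≤ 2 * (1 + C) * (C * sb * r ^ 2) := by
          apply mul_le_mul_of_nonneg_right _ (by positivity)
          linarith
        _ = _ := by ring
    have hL : (a + b) ^ 2 / sb ≤ C ^ 2 * (sb * r ^ 2) := by
      rw [div_le_iff₀ hsb0]
      calc (a + b) ^ 2 ≤ (C * w) ^ 2 := pow_le_pow_left₀ (by positivity) hLw 2
        _ = _ := by rw [hw]; ring
    have : 0 ≤ D2 * (sb * r ^ 2) := by positivity
    calc ks * v ^ 2 ≤ q + (a + b) ^ 2 / sb := htr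
      _ ≤ D1 * (sb * r ^ 2) := by rw [hD1]; linarith
      _ ≤ _ := by linarith

/-! ### Integrals of products -/

theorem lintegral_fin_prod_eq_prod {n : ℕ} {E : Fin n → Type*}
    {mE : ∀ i, MeasurableSpace (E i)} {μ : (i : Fin n) → Measure (E i)} [∀ i, SigmaFinite (μ i)]
    (f : (i : Fin n) → E i → ENNReal) (hf : ∀ i, Measurable (f i)) :
    ∫⁻ x : (i : Fin n) → E i, ∏ i, f i (x i) ∂(Measure.pi μ) = ∏ i, ∫⁻ x, f i x ∂(μ i) := by
  induction n with
  | zero => simp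
  | succ n ih =>
    have hm : Measurable fun x : (i : Fin (n + 1)) → E i => ∏ i, f i (x i) :=
      Finset.measurable_prod _ fun i _ => (hf i).comp (measurable_pi_apply i)
    rw [← ((measurePreserving_piFinSuccAbove μ 0).symm).lintegral_comp hm]
    simp_rw [Fin.prod_univ_succ]
    rw [← ih (fun i => f i.succ) (fun i => hf i.succ),
      ← lintegral_prod_mul (hf 0).aemeasurable
        (Finset.measurable_prod _ fun i _ => (hf i.succ).comp (measurable_pi_apply i)).aemeasurable]
    rfl

theorem lintegral_exp_neg_abs_sub {b : ℝ} (hb : 0 < b) (a : ℝ) :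
    ∫⁻ x : ℝ, ENNReal.ofReal (Real.exp (-b * |x - a|)) = ENNReal.ofReal (2 / b) := by
  rw [lintegral_sub_right_eq_self (fun x => ENNReal.ofReal (Real.exp (-b * |x|))) a]
  have h : ∫ x : ℝ, Real.exp (-b * |x|) = 2 / b := by
    rw [integral_comp_abs (f := fun x => Real.exp (-b * x)), integral_exp_mul_Ioi (by linarith) 0]
    simp
    ring
  have hi : Integrable fun x : ℝ => Real.exp (-b * |x|) :=
    Integrable.of_integral_ne_zero (by rw [h]; positivity)
  rw [← ofReal_integral_eq_lintegral_ofReal hi (Filter.Eventually.of_forall fun _ => by positivity),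
    h]

/-! ### The prior of one column -/

instance sparseBase_factor_sigmaFinite {p : ℕ} (δ : Finset (Fin p)) (k : Fin p) :
    SigmaFinite (if k ∈ δ then (volume : Measure ℝ) else Measure.dirac 0) := by
  split_ifs <;> infer_instance

instance sparseBase_sigmaFinite {p : ℕ} (δ : Finset (Fin p)) : SigmaFinite (sparseBase δ) := by
  unfold sparseBase; infer_instance

theorem measurable_norm1 {p : ℕ} : Measurable (norm1 : (Fin p → ℝ) → ℝ) := by
  unfold norm1
  exact Finset.measurable_sum _ fun k _ => (measurable_pi_apply k).abs

theorem measurable_norm2 {p : ℕ} : Measurable (norm2 : (Fin p → ℝ) → ℝ) := by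
  unfold norm2
  exact (Finset.measurable_sum _ fun k _ => (measurable_pi_apply k).pow_const 2).sqrt

theorem lintegral_columnPrior {p : ℕ} (g : ℕ → ℝ) (ρ : ℝ) (f : (Fin p → ℝ) → ENNReal)
    (hf : Measurable f) :
    ∫⁻ u, f u ∂(columnPrior p g ρ) = ∑ δ : Finset (Fin p), ∫⁻ u,
      ENNReal.ofReal (structWeight g δ * (ρ / 2) ^ δ.card * Real.exp (-ρ * norm1 u)) * f u
        ∂(sparseBase δ) := by
  unfold columnPrior
  rw [lintegral_finsetSum_measure]
  refine Finset.sum_congr rfl fun δ _ => ?_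
  rw [lintegral_withDensity_eq_lintegral_mul _ _ hf]
  · rfl
  · exact ((measurable_norm1.const_mul _).exp.const_mul _).ennreal_ofReal

/-- The integral of a Laplace kernel against a sparse base measure. -/
theorem lintegral_sparseBase_exp_le {p : ℕ} (δ : Finset (Fin p)) {b : ℝ} (hb : 0 < b)
    (a : Fin p → ℝ) :
    ∫⁻ u, ENNReal.ofReal (Real.exp (-b * norm1 (u - a))) ∂(sparseBase δ) ≤
      ENNReal.ofReal ((2 / b) ^ δ.card) := by
  have h1 : ∀ u : Fin p → ℝ, ENNReal.ofReal (Real.exp (-b * norm1 (u - a))) =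
      ∏ k, ENNReal.ofReal (Real.exp (-b * |u k - a k|)) := by
    intro u
    rw [← ENNReal.ofReal_prod_of_nonneg fun _ _ => (Real.exp_pos _).le, ← Real.exp_sum,
      ← Finset.mul_sum]
    rfl
  simp_rw [h1]
  unfold sparseBase
  rw [lintegral_fin_prod_eq_prod (fun k x => ENNReal.ofReal (Real.exp (-b * |x - a k|)))
    (fun k => by fun_prop)]
  have h2 : ∀ k : Fin p, ∫⁻ x, ENNReal.ofReal (Real.exp (-b * |x - a k|))
      ∂(if k ∈ δ then (volume : Measure ℝ) else Measure.dirac 0) ≤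
      if k ∈ δ then ENNReal.ofReal (2 / b) else 1 := by
    intro k
    split_ifs with hk
    · exact (lintegral_exp_neg_abs_sub hb (a k)).le
    -- An inactive coordinate contributes `e^{-b|a_k|}`, which is at most 1.
    · rw [lintegral_dirac]
      rw [ENNReal.ofReal_le_one, Real.exp_le_one_iff]
      nlinarith [abs_nonneg (0 - a k)]
  refine (Finset.prod_le_prod' fun k _ => h2 k).trans ?_
  rw [Finset.prod_ite_mem, Finset.univ_inter, Finset.prod_const,
    ENNReal.ofReal_pow (by positivity)]

/-- The binomial coefficient in the weight cancels the number of models of each size. -/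
theorem sum_structWeight_mul_pow {p : ℕ} (g : ℕ → ℝ) (c : ℝ) :
    ∑ δ : Finset (Fin p), structWeight g δ * c ^ δ.card =
      ∑ m ∈ Finset.range (p + 1), g m * c ^ m := by
  have := Finset.sum_powerset_apply_card (x := (Finset.univ : Finset (Fin p)))
    (fun m => g m / (p.choose m : ℝ) * c ^ m)
  rw [Finset.powerset_univ, Finset.card_univ, Fintype.card_fin] at this
  unfold structWeight
  rw [this]
  refine Finset.sum_congr rfl fun m hm => ?_
  have hc : (p.choose m : ℝ) ≠ 0 := by
    have := Nat.choose_pos (Finset.mem_range_succ_iff.1 hm)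
    positivity
  rw [nsmul_eq_mul]
  field_simp

theorem structWeight_nonneg {p : ℕ} {g : ℕ → ℝ} (hg : ∀ s ≤ p, 0 ≤ g s) (δ : Finset (Fin p)) :
    0 ≤ structWeight g δ := by
  have : δ.card ≤ p := by simpa using Finset.card_le_univ δ
  exact div_nonneg (hg _ this) (Nat.cast_nonneg _)

/-- An upper bound of the unnormalized posterior mass of a set on which the log-likelihood ratio
is dominated by a shifted Laplace kernel. -/
theorem setLIntegral_columnPrior_le {p : ℕ} {g : ℕ → ℝ} (hg : ∀ s ≤ p, 0 ≤ g s) {ρ : ℝ}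
    (hρ : 0 < ρ) (L : (Fin p → ℝ) → ℝ) (hL : Measurable L) (a : Fin p → ℝ) (T : ℝ)
    (A : Set (Fin p → ℝ)) (hA : MeasurableSet A)
    (hbound : ∀ u ∈ A, L u - L a ≤ ρ * norm1 u - ρ * norm1 a - T - ρ / 4 * norm1 (u - a)) :
    ∫⁻ u in A, ENNReal.ofReal (Real.exp (L u)) ∂(columnPrior p g ρ) ≤
      ENNReal.ofReal (Real.exp (L a - ρ * norm1 a - T) *
        ∑ m ∈ Finset.range (p + 1), g m * 4 ^ m) := by
  have hLm : Measurable fun u => ENNReal.ofReal (Real.exp (L u)) := hL.exp.ennreal_ofReal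
  rw [← lintegral_indicator hA, lintegral_columnPrior _ _ _ (hLm.indicator hA),
    ← sum_structWeight_mul_pow, Finset.mul_sum,
    ENNReal.ofReal_sum_of_nonneg fun δ _ => mul_nonneg (Real.exp_pos _).le
      (mul_nonneg (structWeight_nonneg hg δ) (by positivity))]
  refine Finset.sum_le_sum fun δ _ => ?_
  set E := Real.exp (L a - ρ * norm1 a - T) with hE
  have hw := structWeight_nonneg hg δ
  calc _ ≤ ∫⁻ u, ENNReal.ofReal (structWeight g δ * (ρ / 2) ^ δ.card * E) *
        ENNReal.ofReal (Real.exp (-(ρ / 4) * norm1 (u - a))) ∂(sparseBase δ) := by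
        refine lintegral_mono fun u => ?_
        by_cases hu : u ∈ A
        · simp only [Set.indicator_of_mem hu]
          rw [← ENNReal.ofReal_mul (by positivity), ← ENNReal.ofReal_mul (by positivity)]
          apply ENNReal.ofReal_le_ofReal
          rw [mul_assoc, mul_assoc (structWeight g δ * (ρ / 2) ^ δ.card), hE, ← Real.exp_add,
            ← Real.exp_add]
          apply mul_le_mul_of_nonneg_left _ (by positivity)
          apply Real.exp_le_exp.2
          linarith [hbound u hu]
        · simp [Set.indicator_of_notMem hu]
    _ ≤ ENNReal.ofReal (structWeight g δ * (ρ / 2) ^ δ.card * E) *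
        ENNReal.ofReal ((2 / (ρ / 4)) ^ δ.card) := by
        rw [lintegral_const_mul' _ _ ENNReal.ofReal_ne_top]
        exact mul_le_mul_right (lintegral_sparseBase_exp_le δ (by positivity) a) _
    _ = _ := by
        rw [← ENNReal.ofReal_mul (by positivity)]
        congr 1
        -- Prior normalization `ρ/2` against a kernel of rate `ρ/4`, with integral `8/ρ`: a factor 4
        -- per active coordinate.
        have : (ρ / 2) ^ δ.card * (2 / (ρ / 4)) ^ δ.card = 4 ^ δ.card := by
          rw [← mul_pow]
          congr 1
          field_simp
        rw [← this]
        ring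

theorem columnPrior_univ_lt_top {p : ℕ} {g : ℕ → ℝ} (hg : ∀ s ≤ p, 0 ≤ g s) {ρ : ℝ}
    (hρ : 0 < ρ) : columnPrior p g ρ Set.univ < ⊤ := by
  rw [← lintegral_one, lintegral_columnPrior _ _ _ measurable_const]
  refine ENNReal.sum_lt_top.2 fun δ _ => ?_
  have h := lintegral_sparseBase_exp_le δ hρ (0 : Fin p → ℝ)
  have hw := structWeight_nonneg hg δ
  simp_rw [mul_one]
  have e : ∀ u : Fin p → ℝ, ENNReal.ofReal (structWeight g δ * (ρ / 2) ^ δ.card *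
      Real.exp (-ρ * norm1 u)) = ENNReal.ofReal (structWeight g δ * (ρ / 2) ^ δ.card) *
      ENNReal.ofReal (Real.exp (-ρ * norm1 (u - 0))) := by
    intro u
    rw [ENNReal.ofReal_mul (by positivity), sub_zero]
  simp_rw [e]
  rw [lintegral_const_mul' _ _ ENNReal.ofReal_ne_top]
  exact ENNReal.mul_lt_top ENNReal.ofReal_lt_top (h.trans_lt ENNReal.ofReal_lt_top)

/-- A lower bound of the normalizing constant of the posterior, from a box around `a` in the
subspace of vectors with the support of `a`. -/
theorem le_lintegral_columnPrior {p : ℕ} {g : ℕ → ℝ} (hg : ∀ s ≤ p, 0 ≤ g s) {ρ : ℝ}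
    (hρ : 0 < ρ) (L : (Fin p → ℝ) → ℝ) (hL : Measurable L) (a : Fin p → ℝ) (b : ℝ)
    (hbound : ∀ u, norm1 (u - a) ≤ nnz a / ρ → L a - b ≤ L u) :
    ENNReal.ofReal (Real.exp (L a - ρ * norm1 a - b - nnz a) *
        (g (nnz a) / (p.choose (nnz a) : ℝ))) ≤
      ∫⁻ u, ENNReal.ofReal (Real.exp (L u)) ∂(columnPrior p g ρ) := by
  have hLm : Measurable fun u => ENNReal.ofReal (Real.exp (L u)) := hL.exp.ennreal_ofReal
  rw [lintegral_columnPrior _ _ _ hLm]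
  set S : Finset (Fin p) := Finset.univ.filter fun k => a k ≠ 0 with hS
  refine le_trans ?_ (Finset.single_le_sum (f := fun δ : Finset (Fin p) => ∫⁻ u,
      ENNReal.ofReal (structWeight g δ * (ρ / 2) ^ δ.card * Real.exp (-ρ * norm1 u)) *
        ENNReal.ofReal (Real.exp (L u)) ∂(sparseBase δ)) (fun _ _ => zero_le) (Finset.mem_univ S))
  have hcard : S.card = nnz a := rfl
  have hw := structWeight_nonneg hg S
  -- With half-width `1/ρ` the box volume `(2/ρ)^s` cancels the normalization `(ρ/2)^s` exactly, and
  -- the penalty grows by at most 1 per active coordinate, hence the `nnz a` in the exponent.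
  let I : Fin p → Set ℝ := fun k => if k ∈ S then Set.Icc (a k - 1 / ρ) (a k + 1 / ρ) else {0}
  have hIm : ∀ k, MeasurableSet (I k) := by
    intro k
    simp only [I]
    split_ifs
    · exact measurableSet_Icc
    · exact measurableSet_singleton 0
  have hBm : MeasurableSet (Set.univ.pi I) := MeasurableSet.univ_pi hIm
  have hvol : sparseBase S (Set.univ.pi I) = ENNReal.ofReal ((2 / ρ) ^ S.card) := by
    unfold sparseBase
    rw [Measure.pi_pi]
    have : ∀ k, (if k ∈ S then (volume : Measure ℝ) else Measure.dirac 0) (I k) =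
        if k ∈ S then ENNReal.ofReal (2 / ρ) else 1 := by
      intro k
      simp only [I]
      split_ifs
      · rw [Real.volume_Icc]; congr 1; ring
      · simp
    simp_rw [this]
    rw [Finset.prod_ite_mem, Finset.univ_inter, Finset.prod_const,
      ENNReal.ofReal_pow (by positivity)]
  have hnear : ∀ u ∈ Set.univ.pi I, norm1 (u - a) ≤ nnz a / ρ := by
    intro u hu
    unfold norm1
    have h1 : ∀ k, |(u - a) k| ≤ if k ∈ S then 1 / ρ else 0 := by
      intro k
      have hk := hu k (Set.mem_univ k)
      simp only [I] at hk
      split_ifs at hk ⊢ with hkS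
      · rw [Pi.sub_apply, abs_le]
        constructor <;> linarith [hk.1, hk.2]
      · have h0 : a k = 0 := by simpa [hS] using hkS
        have h1 : u k = 0 := hk
        simp [h0, h1]
    refine (Finset.sum_le_sum fun k _ => h1 k).trans ?_
    rw [Finset.sum_ite_mem, Finset.univ_inter, Finset.sum_const, hcard, nsmul_eq_mul]
    exact le_of_eq (by ring)
  have htri : ∀ u : Fin p → ℝ, norm1 u ≤ norm1 a + norm1 (u - a) := by
    intro u
    unfold norm1
    rw [← Finset.sum_add_distrib]
    refine Finset.sum_le_sum fun k _ => ?_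
    have := abs_add_le (a k) (u k - a k)
    simpa using this
  set W := structWeight g S * (ρ / 2) ^ S.card * Real.exp (L a - ρ * norm1 a - b - nnz a) with hW
  calc _ = ENNReal.ofReal W * ENNReal.ofReal ((2 / ρ) ^ S.card) := by
        rw [← ENNReal.ofReal_mul (by positivity)]
        congr 1
        have : (ρ / 2) ^ S.card * (2 / ρ) ^ S.card = 1 := by
          rw [← mul_pow]
          have : ρ / 2 * (2 / ρ) = 1 := by field_simp
          rw [this, one_pow]
        change _ * structWeight g S = _
        rw [hW]
        linear_combination (-(structWeight g S) * Real.exp (L a - ρ * norm1 a - b - nnz a)) * this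
    _ = ∫⁻ u in Set.univ.pi I, ENNReal.ofReal W ∂(sparseBase S) := by
        rw [setLIntegral_const, hvol]
    _ ≤ ∫⁻ u in Set.univ.pi I, ENNReal.ofReal (structWeight g S * (ρ / 2) ^ S.card *
          Real.exp (-ρ * norm1 u)) * ENNReal.ofReal (Real.exp (L u)) ∂(sparseBase S) := by
        refine setLIntegral_mono' hBm fun u hu => ?_
        rw [← ENNReal.ofReal_mul (by positivity)]
        apply ENNReal.ofReal_le_ofReal
        rw [hW, mul_assoc (structWeight g S * (ρ / 2) ^ S.card), ← Real.exp_add]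
        apply mul_le_mul_of_nonneg_left _ (by positivity)
        apply Real.exp_le_exp.2
        have h1 := hnear u hu
        have h2 := hbound u h1
        have h3 : ρ * norm1 u ≤ ρ * norm1 a + nnz a := by
          have h4 : ρ * norm1 u ≤ ρ * (norm1 a + nnz a / ρ) :=
            mul_le_mul_of_nonneg_left ((htri u).trans (by linarith)) hρ.le
          have h5 : ρ * (norm1 a + nnz a / ρ) = ρ * norm1 a + nnz a := by field_simp
          linarith
        linarith
    _ ≤ _ := setLIntegral_le_lintegral _ _

/-- Posterior mass bound for one column. -/
theorem column_posterior_le {p : ℕ} {g : ℕ → ℝ} (hg : ∀ s ≤ p, 0 ≤ g s) {ρ : ℝ}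
    (hρ : 0 < ρ) (L : (Fin p → ℝ) → ℝ) (hL : Measurable L) (a : Fin p → ℝ) (b T ε : ℝ)
    (hε : 0 ≤ ε) (A : Set (Fin p → ℝ)) (hA : MeasurableSet A)
    (hlow : ∀ u, norm1 (u - a) ≤ nnz a / ρ → L a - b ≤ L u)
    (hup : ∀ u ∈ A, L u - L a ≤ ρ * norm1 u - ρ * norm1 a - T - ρ / 4 * norm1 (u - a))
    (hfin : Real.exp (-T) * ∑ m ∈ Finset.range (p + 1), g m * 4 ^ m ≤
      ε * (Real.exp (-b - nnz a) * (g (nnz a) / (p.choose (nnz a) : ℝ)))) :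
    ∫⁻ u in A, ENNReal.ofReal (Real.exp (L u)) ∂(columnPrior p g ρ) ≤
      ENNReal.ofReal ε * ∫⁻ u, ENNReal.ofReal (Real.exp (L u)) ∂(columnPrior p g ρ) := by
  refine (setLIntegral_columnPrior_le hg hρ L hL a T A hA hup).trans ?_
  refine le_trans ?_ (mul_le_mul_right (le_lintegral_columnPrior hg hρ L hL a b hlow) _)
  rw [← ENNReal.ofReal_mul hε]
  apply ENNReal.ofReal_le_ofReal
  have e1 : Real.exp (L a - ρ * norm1 a - T) = Real.exp (L a - ρ * norm1 a) * Real.exp (-T) := by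
    rw [← Real.exp_add]; ring_nf
  have e2 : Real.exp (L a - ρ * norm1 a - b - nnz a) =
      Real.exp (L a - ρ * norm1 a) * Real.exp (-b - nnz a) := by
    rw [← Real.exp_add]; ring_nf
  rw [e1, e2]
  have := mul_le_mul_of_nonneg_left hfin (Real.exp_pos (L a - ρ * norm1 a)).le
  linarith

/-! ### The conditional log-likelihoods -/

/-- The log-likelihood of the logistic regression of the `j`-th variable on the others. -/
noncomputable def colLogLik {p n : ℕ} (z : Fin n → Fin p → Bool) (j : Fin p)
    (u : Fin p → ℝ) : ℝ :=
  ∑ i, (bit (z i j) * (u ⬝ᵥ plugOne j (z i)) - Real.log (1 + Real.exp (u ⬝ᵥ plugOne j (z i))))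

/-- The `k`-th component of the score of the `j`-th logistic regression, for one observation. -/
noncomputable def scoreTerm {p : ℕ} (a : Fin p → ℝ) (j k : Fin p) (x : Fin p → Bool) : ℝ :=
  (bit (x j) - sigmoid (a ⬝ᵥ plugOne j x)) * plugOne j x k

/-- The `(s, t)` entry of the information matrix of the `j`-th logistic regression, for one
observation. -/
noncomputable def infoTerm {p : ℕ} (a : Fin p → ℝ) (j s t : Fin p) (x : Fin p → Bool) : ℝ :=
  logisticSecond (a ⬝ᵥ plugOne j x) * (plugOne j x s * plugOne j x t)

theorem bit_nonneg (b : Bool) : 0 ≤ bit b := by cases b <;> simp [bit]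

theorem bit_le_one (b : Bool) : bit b ≤ 1 := by cases b <;> simp [bit]

theorem plugOne_nonneg {p : ℕ} (j : Fin p) (x : Fin p → Bool) (k : Fin p) :
    0 ≤ plugOne j x k := by
  unfold plugOne; split_ifs
  · exact zero_le_one
  · exact bit_nonneg _

theorem plugOne_le_one {p : ℕ} (j : Fin p) (x : Fin p → Bool) (k : Fin p) :
    plugOne j x k ≤ 1 := by
  unfold plugOne; split_ifs
  · exact le_rfl
  · exact bit_le_one _

theorem abs_dotProduct_plugOne_le {p : ℕ} (u : Fin p → ℝ) (j : Fin p) (x : Fin p → Bool) :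
    |u ⬝ᵥ plugOne j x| ≤ norm1 u := by
  unfold dotProduct norm1
  refine (Finset.abs_sum_le_sum_abs _ _).trans (Finset.sum_le_sum fun k _ => ?_)
  rw [abs_mul, abs_of_nonneg (plugOne_nonneg j x k)]
  exact mul_le_of_le_one_right (abs_nonneg _) (plugOne_le_one j x k)

theorem dotProduct_plugOne {p : ℕ} (u : Fin p → ℝ) (j : Fin p) (x : Fin p → Bool) :
    u ⬝ᵥ plugOne j x = u j + ∑ k ∈ Finset.univ.erase j, u k * bit (x k) := by
  unfold dotProduct
  rw [← Finset.add_sum_erase _ _ (Finset.mem_univ j)]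
  congr 1
  · simp [plugOne]
  · refine Finset.sum_congr rfl fun k hk => ?_
    simp [plugOne, Finset.ne_of_mem_erase hk]

theorem measurable_dotProduct {p : ℕ} (v : Fin p → ℝ) :
    Measurable fun u : Fin p → ℝ => u ⬝ᵥ v := by
  unfold dotProduct
  exact Finset.measurable_sum _ fun k _ => (measurable_pi_apply k).mul_const _

theorem measurable_colLogLik {p n : ℕ} (z : Fin n → Fin p → Bool) (j : Fin p) :
    Measurable (colLogLik z j) := by
  unfold colLogLik
  refine Finset.measurable_sum _ fun i _ => ?_
  have h := measurable_dotProduct (plugOne j (z i))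
  exact (h.const_mul _).sub ((h.exp.const_add 1).log)

/-- Each factor involves one column only; with the product prior this makes the columns independent
under the quasi-posterior. -/
theorem quasiLik_eq_prod {p n : ℕ} (z : Fin n → Fin p → Bool) (θ : Matrix (Fin p) (Fin p) ℝ) :
    quasiLik z θ = ∏ j, Real.exp (colLogLik z j (column θ j)) := by
  unfold quasiLik colLogLik
  refine Finset.prod_congr rfl fun j _ => ?_
  rw [Real.exp_sum]
  refine Finset.prod_congr rfl fun i _ => ?_
  rw [Real.exp_sub, Real.exp_log (by positivity), dotProduct_plugOne]
  rfl

/-- The log-likelihood ratio is the linear term given by the score, minus a Bregman divergence. -/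
theorem colLogLik_sub {p n : ℕ} (z : Fin n → Fin p → Bool) (j : Fin p) (a u : Fin p → ℝ) :
    colLogLik z j (a + u) - colLogLik z j a =
      ∑ k, u k * ∑ i, scoreTerm a j k (z i) -
      ∑ i, (Real.log (1 + Real.exp (a ⬝ᵥ plugOne j (z i) + u ⬝ᵥ plugOne j (z i))) -
        Real.log (1 + Real.exp (a ⬝ᵥ plugOne j (z i))) -
        sigmoid (a ⬝ᵥ plugOne j (z i)) * (u ⬝ᵥ plugOne j (z i))) := by
  have h1 : ∑ k, u k * ∑ i, scoreTerm a j k (z i) =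
      ∑ i, (bit (z i j) - sigmoid (a ⬝ᵥ plugOne j (z i))) * (u ⬝ᵥ plugOne j (z i)) := by
    simp_rw [Finset.mul_sum]
    rw [Finset.sum_comm]
    refine Finset.sum_congr rfl fun i _ => ?_
    unfold scoreTerm dotProduct
    rw [Finset.mul_sum]
    exact Finset.sum_congr rfl fun k _ => by ring
  rw [h1]
  unfold colLogLik
  rw [← Finset.sum_sub_distrib, ← Finset.sum_sub_distrib]
  refine Finset.sum_congr rfl fun i _ => ?_
  rw [add_dotProduct]
  ring

theorem abs_sum_mul_le {p : ℕ} (u v : Fin p → ℝ) (l : ℝ) (hv : ∀ k, |v k| ≤ l) :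
    |∑ k, u k * v k| ≤ l * norm1 u := by
  unfold norm1
  rw [Finset.mul_sum]
  refine (Finset.abs_sum_le_sum_abs _ _).trans (Finset.sum_le_sum fun k _ => ?_)
  rw [abs_mul, mul_comm]
  exact mul_le_mul_of_nonneg_right (hv k) (abs_nonneg _)

/-- The quadratic form of the empirical information matrix, multiplied by `n`. -/
noncomputable def empiricalInfo {p n : ℕ} (z : Fin n → Fin p → Bool) (a : Fin p → ℝ) (j : Fin p)
    (u : Fin p → ℝ) : ℝ :=
  ∑ i, logisticSecond (a ⬝ᵥ plugOne j (z i)) * (u ⬝ᵥ plugOne j (z i)) ^ 2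

theorem empiricalInfo_nonneg {p n : ℕ} (z : Fin n → Fin p → Bool) (a : Fin p → ℝ) (j : Fin p)
    (u : Fin p → ℝ) : 0 ≤ empiricalInfo z a j u :=
  Finset.sum_nonneg fun _ _ => mul_nonneg (logisticSecond_nonneg _) (sq_nonneg _)

/-- Hölder's inequality bounds the linear term. As the covariates lie in `[0,1]`, every `|⟨u, x⟩|`
is at most `‖u‖₁`, so the logistic bounds share one denominator and sum to the empirical
information. -/
theorem colLogLik_sub_le {p n : ℕ} (z : Fin n → Fin p → Bool) (j : Fin p) (a u : Fin p → ℝ)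
    (l : ℝ) (hl : ∀ k, |∑ i, scoreTerm a j k (z i)| ≤ l) :
    colLogLik z j (a + u) - colLogLik z j a ≤
      l * norm1 u - empiricalInfo z a j u / (2 * (1 + norm1 u)) := by
  rw [colLogLik_sub]
  have h1 := (abs_le.1 (abs_sum_mul_le u (fun k => ∑ i, scoreTerm a j k (z i)) l hl)).2
  have hn := norm1_nonneg u
  have h2 : empiricalInfo z a j u / (2 * (1 + norm1 u)) ≤
      ∑ i, (Real.log (1 + Real.exp (a ⬝ᵥ plugOne j (z i) + u ⬝ᵥ plugOne j (z i))) -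
        Real.log (1 + Real.exp (a ⬝ᵥ plugOne j (z i))) -
        sigmoid (a ⬝ᵥ plugOne j (z i)) * (u ⬝ᵥ plugOne j (z i))) := by
    unfold empiricalInfo
    rw [Finset.sum_div]
    refine Finset.sum_le_sum fun i _ => le_trans ?_ (logistic_bregman_ge _ _)
    rw [mul_div_assoc]
    apply mul_le_mul_of_nonneg_left _ (logisticSecond_nonneg _)
    apply div_le_div_of_nonneg_left (sq_nonneg _) (by positivity)
    have := abs_dotProduct_plugOne_le u j (z i)
    linarith
  linarith

/-- Needed only on the small box that bounds the normalizing constant from below. -/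
theorem le_colLogLik_sub {p n : ℕ} (z : Fin n → Fin p → Bool) (j : Fin p) (a u : Fin p → ℝ)
    (l : ℝ) (hl : ∀ k, |∑ i, scoreTerm a j k (z i)| ≤ l) (hu : norm1 u ≤ 1) :
    -(l * norm1 u) - n * norm1 u ^ 2 ≤ colLogLik z j (a + u) - colLogLik z j a := by
  rw [colLogLik_sub]
  have h1 := (abs_le.1 (abs_sum_mul_le u (fun k => ∑ i, scoreTerm a j k (z i)) l hl)).1
  have h2 : ∑ i, (Real.log (1 + Real.exp (a ⬝ᵥ plugOne j (z i) + u ⬝ᵥ plugOne j (z i))) -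
        Real.log (1 + Real.exp (a ⬝ᵥ plugOne j (z i))) -
        sigmoid (a ⬝ᵥ plugOne j (z i)) * (u ⬝ᵥ plugOne j (z i))) ≤ ∑ _i : Fin n, norm1 u ^ 2 := by
    refine Finset.sum_le_sum fun i _ => ?_
    have h3 := abs_dotProduct_plugOne_le u j (z i)
    refine (logistic_bregman_le _ _ (h3.trans hu)).trans ?_
    rw [← sq_abs (u ⬝ᵥ plugOne j (z i))]
    exact pow_le_pow_left₀ (abs_nonneg _) h3 2
  rw [Finset.sum_const, Finset.card_univ, Fintype.card_fin, nsmul_eq_mul] at h2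
  linarith

/-! ### The product structure of the quasi-posterior -/

theorem measurable_entry {p : ℕ} (k j : Fin p) :
    Measurable fun θ : Matrix (Fin p) (Fin p) ℝ => θ k j :=
  (measurable_pi_apply j).comp (measurable_pi_apply (X := fun _ : Fin p => Fin p → ℝ) k)

theorem measurable_column {p : ℕ} (j : Fin p) :
    Measurable fun θ : Matrix (Fin p) (Fin p) ℝ => column θ j :=
  measurable_pi_lambda _ fun k => measurable_entry k j

theorem measurable_ofColumns {p : ℕ} :
    Measurable fun c : Fin p → Fin p → ℝ => (Matrix.of fun k j => c j k : Matrix _ _ ℝ) := by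
  refine measurable_pi_lambda (X := fun _ : Fin p => Fin p → ℝ) _ fun k =>
    measurable_pi_lambda _ fun j => ?_
  exact (measurable_pi_apply k).comp (measurable_pi_apply (X := fun _ : Fin p => Fin p → ℝ) j)

theorem measurable_quasiLik {p n : ℕ} (z : Fin n → Fin p → Bool) :
    Measurable fun θ : Matrix (Fin p) (Fin p) ℝ => ENNReal.ofReal (quasiLik z θ) := by
  simp_rw [quasiLik_eq_prod]
  exact (Finset.measurable_prod _ fun j _ =>
    ((measurable_colLogLik z j).comp (measurable_column j)).exp).ennreal_ofReal

/-- A set that depends on one column only has quasi-posterior probability at most the bound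
available for that column. -/
theorem quasiPosterior_column_le {p n : ℕ} {g : ℕ → ℝ} (hg : ∀ s ≤ p, 0 ≤ g s) {ρ : ℝ}
    (hρ : 0 < ρ) (z : Fin n → Fin p → Bool) (j : Fin p) (A : Set (Fin p → ℝ))
    (hA : MeasurableSet A) (ε : ENNReal)
    (h : ∫⁻ u in A, ENNReal.ofReal (Real.exp (colLogLik z j u)) ∂(columnPrior p g ρ) ≤
      ε * ∫⁻ u, ENNReal.ofReal (Real.exp (colLogLik z j u)) ∂(columnPrior p g ρ)) :
    quasiPosterior g ρ z {θ | column θ j ∈ A} ≤ ε := by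
  have : IsFiniteMeasure (columnPrior p g ρ) := ⟨columnPrior_univ_lt_top hg hρ⟩
  set F : Fin p → (Fin p → ℝ) → ENNReal :=
    fun i u => ENNReal.ofReal (Real.exp (colLogLik z i u)) with hF
  have hFm : ∀ i, Measurable (F i) := fun i => (measurable_colLogLik z i).exp.ennreal_ofReal
  set μ := (matrixPrior p g ρ).withDensity fun θ => ENNReal.ofReal (quasiLik z θ) with hμ
  have hAm : MeasurableSet {θ : Matrix (Fin p) (Fin p) ℝ | column θ j ∈ A} :=
    measurable_column j hA
  have hcol : ∀ (c : Fin p → Fin p → ℝ) (i : Fin p),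
      column (Matrix.of fun k j => c j k : Matrix (Fin p) (Fin p) ℝ) i = c i := fun c i => rfl
  have hprod : ∀ c : Fin p → Fin p → ℝ,
      ENNReal.ofReal (quasiLik z (Matrix.of fun k j => c j k)) = ∏ i, F i (c i) := by
    intro c
    rw [quasiLik_eq_prod, ENNReal.ofReal_prod_of_nonneg fun _ _ => (Real.exp_pos _).le]
    rfl
  have huniv : μ Set.univ = ∏ i, ∫⁻ u, F i u ∂(columnPrior p g ρ) := by
    rw [hμ, withDensity_apply _ MeasurableSet.univ, Measure.restrict_univ, matrixPrior,
      lintegral_map (measurable_quasiLik z) measurable_ofColumns]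
    simp_rw [hprod]
    exact lintegral_fin_prod_eq_prod F hFm
  have hset : μ {θ | column θ j ∈ A} = (∫⁻ u in A, F j u ∂(columnPrior p g ρ)) *
      ∏ i ∈ Finset.univ.erase j, ∫⁻ u, F i u ∂(columnPrior p g ρ) := by
    -- The indicator of the event goes into the `j`-th factor, so numerator and normalizing constant
    -- share all the other factors.
    let G : Fin p → (Fin p → ℝ) → ENNReal := fun i => if i = j then A.indicator (F j) else F i
    have hGm : ∀ i, Measurable (G i) := by
      intro i
      simp only [G]
      split_ifs
      · exact (hFm j).indicator hA
      · exact hFm i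
    rw [hμ, withDensity_apply _ hAm, matrixPrior,
      ← lintegral_indicator hAm,
      lintegral_map ((measurable_quasiLik z).indicator hAm) measurable_ofColumns]
    have e : ∀ c : Fin p → Fin p → ℝ,
        Set.indicator {θ : Matrix (Fin p) (Fin p) ℝ | column θ j ∈ A}
          (fun θ => ENNReal.ofReal (quasiLik z θ)) (Matrix.of fun k j => c j k) =
        ∏ i, G i (c i) := by
      intro c
      rw [← Finset.mul_prod_erase _ _ (Finset.mem_univ j)]
      have e1 : ∏ i ∈ Finset.univ.erase j, G i (c i) = ∏ i ∈ Finset.univ.erase j, F i (c i) :=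
        Finset.prod_congr rfl fun i hi => by simp [G, Finset.ne_of_mem_erase hi]
      rw [e1]
      by_cases hc : c j ∈ A
      · rw [Set.indicator_of_mem (show _ ∈ {θ : Matrix (Fin p) (Fin p) ℝ | column θ j ∈ A} from hc),
          hprod, ← Finset.mul_prod_erase _ _ (Finset.mem_univ j)]
        simp [G, Set.indicator_of_mem hc]
      · rw [Set.indicator_of_notMem
          (show _ ∉ {θ : Matrix (Fin p) (Fin p) ℝ | column θ j ∈ A} from hc)]
        simp [G, Set.indicator_of_notMem hc]
    simp_rw [e]
    rw [lintegral_fin_prod_eq_prod G hGm, ← Finset.mul_prod_erase _ _ (Finset.mem_univ j)]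
    congr 1
    · simp only [G, if_true]
      rw [lintegral_indicator hA]
    · exact Finset.prod_congr rfl fun i hi => by simp [G, Finset.ne_of_mem_erase hi]
  have hle : μ {θ | column θ j ∈ A} ≤ ε * μ Set.univ := by
    rw [hset, huniv, ← Finset.mul_prod_erase _ _ (Finset.mem_univ j), ← mul_assoc]
    exact mul_le_mul_left h _
  change ((μ Set.univ)⁻¹ • μ) {θ | column θ j ∈ A} ≤ ε
  rw [Measure.smul_apply, smul_eq_mul]
  -- In `ENNReal`, `x⁻¹ * x ≤ 1` also for `x = 0` and `x = ⊤`, so the normalizing constant need not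
  -- be shown positive and finite.
  calc (μ Set.univ)⁻¹ * μ {θ | column θ j ∈ A} ≤ (μ Set.univ)⁻¹ * (ε * μ Set.univ) :=
        mul_le_mul_right hle _
    _ = ε * ((μ Set.univ)⁻¹ * μ Set.univ) := by ring
    _ ≤ ε * 1 := mul_le_mul_right (ENNReal.inv_mul_le_one _) _
    _ = ε := mul_one ε

theorem quasiPosterior_le_one {p n : ℕ} (g : ℕ → ℝ) (ρ : ℝ) (z : Fin n → Fin p → Bool)
    (B : Set (Matrix (Fin p) (Fin p) ℝ)) : quasiPosterior g ρ z B ≤ 1 := by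
  set μ := (matrixPrior p g ρ).withDensity fun θ => ENNReal.ofReal (quasiLik z θ)
  change ((μ Set.univ)⁻¹ • μ) B ≤ 1
  rw [Measure.smul_apply, smul_eq_mul]
  exact (mul_le_mul_right (measure_mono (Set.subset_univ B)) _).trans (ENNReal.inv_mul_le_one _)

/-! ### Moments under the Ising model -/

/-- The conditional odds of the `j`-th variable given the others: the `j`-th regression is correctly
specified. Symmetry merges the pairs `(j, l)` and `(i, j)` into the single column `j`. -/
theorem isingWeight_update_true {p : ℕ} {θ : Matrix (Fin p) (Fin p) ℝ} (hθ : θ.IsSymm)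
    (j : Fin p) (x : Fin p → Bool) :
    isingWeight θ (Function.update x j true) =
      isingWeight θ (Function.update x j false) * Real.exp (column θ j ⬝ᵥ plugOne j x) := by
  unfold isingWeight
  rw [← Real.exp_add, dotProduct_plugOne]
  congr 1
  set T : Fin p → ℝ := fun k => bit (Function.update x j true k) with hT
  set F : Fin p → ℝ := fun k => bit (Function.update x j false k) with hF
  have hTF : ∀ k, T k = F k + if k = j then 1 else 0 := by
    intro k
    by_cases hk : k = j
    · subst hk; simp [hT, hF, bit]
    · simp [hT, hF, hk]
  have hFj : F j = 0 := by simp [hF, bit]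
  have hFk : ∀ k, k ≠ j → F k = bit (x k) := fun k hk => by simp [hF, hk]
  have h1 : ∑ k, θ k k * T k = ∑ k, θ k k * F k + θ j j := by
    simp_rw [hTF, mul_add, Finset.sum_add_distrib]
    simp
  have h2 : ∑ i, ∑ l, (if i < l then θ i l * T i * T l else 0) =
      ∑ i, ∑ l, (if i < l then θ i l * F i * F l else 0) +
        ∑ k ∈ Finset.univ.erase j, column θ j k * bit (x k) := by
    have e : ∀ i l, (if i < l then θ i l * T i * T l else 0) =
        (if i < l then θ i l * F i * F l else 0) +
          ((if i = j then (if j < l then θ j l * F l else 0) else 0) +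
            (if l = j then (if i < j then θ i j * F i else 0) else 0)) := by
      intro i l
      rw [hTF i, hTF l]
      by_cases hi : i = j
      · subst hi
        by_cases hl : l = i
        · subst hl; simp
        · simp [hl, hFj]
      · by_cases hl : l = j
        · subst hl; simp [hi, hFj]
        · simp [hi, hl]
    simp_rw [e, Finset.sum_add_distrib]
    congr 1
    rw [Finset.sum_comm (f := fun i l => if i = j then (if j < l then θ j l * F l else 0) else 0)]
    simp only [Finset.sum_ite_eq', Finset.mem_univ, if_true]
    rw [← Finset.sum_add_distrib, ← Finset.add_sum_erase _ _ (Finset.mem_univ j)]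
    simp only [lt_irrefl, if_false, add_zero, zero_add]
    refine Finset.sum_congr rfl fun k hk => ?_
    have hkj := Finset.ne_of_mem_erase hk
    rw [← hFk k hkj]
    have hs : θ j k = θ k j := hθ.apply k j
    rcases lt_or_gt_of_ne hkj with h | h
    · simp [h, h.not_gt, column]
    · simp [h, h.not_gt, column, hs]
  change ∑ k, θ k k * T k + ∑ i, ∑ l, (if i < l then θ i l * T i * T l else 0) =
    ∑ k, θ k k * F k + ∑ i, ∑ l, (if i < l then θ i l * F i * F l else 0) +
      (θ j j + ∑ k ∈ Finset.univ.erase j, column θ j k * bit (x k))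
  rw [h1, h2]
  ring

theorem plugOne_update {p : ℕ} (j : Fin p) (x : Fin p → Bool) (b : Bool) :
    plugOne j (Function.update x j b) = plugOne j x := by
  ext k
  unfold plugOne
  split_ifs with h
  · rfl
  · rw [Function.update_of_ne h]

/-- The score has mean zero. -/
theorem sum_isingDensity_scoreTerm {p : ℕ} {θ : Matrix (Fin p) (Fin p) ℝ} (hθ : θ.IsSymm)
    (j k : Fin p) : ∑ x, isingDensity θ x * scoreTerm (column θ j) j k x = 0 := by
  set f : (Fin p → Bool) → ℝ := fun x => isingDensity θ x * scoreTerm (column θ j) j k x with hf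
  have hpair : ∀ x, f (Function.update x j true) + f (Function.update x j false) = 0 := by
    intro x
    simp only [hf, isingDensity, scoreTerm, plugOne_update, Function.update_self,
      isingWeight_update_true hθ]
    unfold sigmoid bit
    have h1 : 1 + Real.exp (column θ j ⬝ᵥ plugOne j x) ≠ 0 := by positivity
    have h2 := (isingConst_pos θ).ne'
    simp only [if_true, Bool.false_eq_true, if_false]
    field_simp
    ring
  -- Flipping the `j`-th bit changes the sign of each term by `hpair`, so the sum equals its own
  -- negative.
  have hinv : Function.Involutive fun x : Fin p → Bool => Function.update x j (!x j) := by
    intro x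
    simp
  have hneg : ∀ x : Fin p → Bool, f (Function.Involutive.toPerm _ hinv x) = -f x := by
    intro x
    have := hpair x
    change f (Function.update x j (!x j)) = -f x
    rcases hx : x j with _ | _
    · have hxx : Function.update x j false = x := by rw [← hx, Function.update_eq_self]
      rw [hxx] at this
      simp only [Bool.not_false]
      linarith
    · have hxx : Function.update x j true = x := by rw [← hx, Function.update_eq_self]
      rw [hxx] at this
      simp only [Bool.not_true]
      linarith
  have h := Equiv.sum_comp (Function.Involutive.toPerm _ hinv) f
  simp_rw [hneg, Finset.sum_neg_distrib] at h
  linarith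

theorem isingDensity_nonneg {p : ℕ} (θ : Matrix (Fin p) (Fin p) ℝ) (x : Fin p → Bool) :
    0 ≤ isingDensity θ x := (div_pos (isingWeight_pos θ x) (isingConst_pos θ)).le

theorem sum_isingDensity {p : ℕ} (θ : Matrix (Fin p) (Fin p) ℝ) :
    ∑ x, isingDensity θ x = 1 := by
  unfold isingDensity
  rw [← Finset.sum_div]
  exact div_self (isingConst_pos θ).ne'

/-! ### The information matrix: entry bounds, positivity, empirical comparison -/

theorem infoTerm_nonneg {p : ℕ} (a : Fin p → ℝ) (j s t : Fin p) (x : Fin p → Bool) :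
    0 ≤ infoTerm a j s t x :=
  mul_nonneg (logisticSecond_nonneg _) (mul_nonneg (plugOne_nonneg _ _ _) (plugOne_nonneg _ _ _))

theorem infoTerm_le {p : ℕ} (a : Fin p → ℝ) (j s t : Fin p) (x : Fin p → Bool) :
    infoTerm a j s t x ≤ 1 / 4 := by
  have h1 : plugOne j x s * plugOne j x t ≤ 1 :=
    mul_le_one₀ (plugOne_le_one _ _ _) (plugOne_nonneg _ _ _) (plugOne_le_one _ _ _)
  exact (mul_le_of_le_one_right (logisticSecond_nonneg _) h1).trans (logisticSecond_le _)

theorem fisher_apply {p : ℕ} (θ : Matrix (Fin p) (Fin p) ℝ) (j s t : Fin p) :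
    fisher θ j s t = ∑ x, isingDensity θ x * infoTerm (column θ j) j s t x := rfl

theorem fisher_nonneg {p : ℕ} (θ : Matrix (Fin p) (Fin p) ℝ) (j s t : Fin p) :
    0 ≤ fisher θ j s t := by
  rw [fisher_apply]
  exact Finset.sum_nonneg fun x _ => mul_nonneg (isingDensity_nonneg θ x) (infoTerm_nonneg _ _ _ _ _)

theorem fisher_le {p : ℕ} (θ : Matrix (Fin p) (Fin p) ℝ) (j s t : Fin p) :
    fisher θ j s t ≤ 1 / 4 := by
  rw [fisher_apply]
  calc _ ≤ ∑ x, isingDensity θ x * (1 / 4) :=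
        Finset.sum_le_sum fun x _ =>
          mul_le_mul_of_nonneg_left (infoTerm_le _ _ _ _ _) (isingDensity_nonneg θ x)
    _ = 1 / 4 := by rw [← Finset.sum_mul, sum_isingDensity, one_mul]

theorem fisher_isSymm {p : ℕ} (θ : Matrix (Fin p) (Fin p) ℝ) (j : Fin p) :
    (fisher θ j).IsSymm := by
  ext s t
  rw [Matrix.transpose_apply, fisher_apply, fisher_apply]
  refine Finset.sum_congr rfl fun x _ => ?_
  unfold infoTerm
  ring

theorem quadForm_eq_sum {p : ℕ} (H : Matrix (Fin p) (Fin p) ℝ) (u : Fin p → ℝ) :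
    u ⬝ᵥ H.mulVec u = ∑ s, ∑ t, u s * u t * H s t := by
  simp only [dotProduct, Matrix.mulVec, Finset.mul_sum]
  exact Finset.sum_congr rfl fun s _ => Finset.sum_congr rfl fun t _ => by ring

theorem sum_mul_infoTerm {p : ℕ} (a u : Fin p → ℝ) (j : Fin p) (x : Fin p → Bool) :
    ∑ s, ∑ t, u s * u t * infoTerm a j s t x =
      logisticSecond (a ⬝ᵥ plugOne j x) * (u ⬝ᵥ plugOne j x) ^ 2 := by
  unfold infoTerm
  generalize logisticSecond (a ⬝ᵥ plugOne j x) = c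
  rw [sq, dotProduct, Finset.sum_mul_sum, Finset.mul_sum]
  refine Finset.sum_congr rfl fun s _ => ?_
  rw [Finset.mul_sum]
  exact Finset.sum_congr rfl fun t _ => by ring

theorem fisher_quadForm_nonneg {p : ℕ} (θ : Matrix (Fin p) (Fin p) ℝ) (j : Fin p)
    (u : Fin p → ℝ) : 0 ≤ u ⬝ᵥ (fisher θ j).mulVec u := by
  have h : u ⬝ᵥ (fisher θ j).mulVec u = ∑ x, isingDensity θ x *
      (logisticSecond (column θ j ⬝ᵥ plugOne j x) * (u ⬝ᵥ plugOne j x) ^ 2) := by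
    rw [quadForm_eq_sum]
    simp_rw [← sum_mul_infoTerm, fisher_apply, Finset.mul_sum]
    rw [Finset.sum_comm (s := Finset.univ (α := Fin p → Bool))]
    refine Finset.sum_congr rfl fun s _ => ?_
    rw [Finset.sum_comm (s := Finset.univ (α := Fin p → Bool))]
    exact Finset.sum_congr rfl fun t _ => Finset.sum_congr rfl fun x _ => by ring
  rw [h]
  exact Finset.sum_nonneg fun x _ => mul_nonneg (isingDensity_nonneg θ x)
    (mul_nonneg (logisticSecond_nonneg _) (sq_nonneg _))

/-- Hölder's inequality applied twice: an entrywise error `τ` costs `τ‖u‖₁²` in the quadratic form,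
without any sparsity of `u`. -/
theorem fisher_quadForm_le {p n : ℕ} (θ : Matrix (Fin p) (Fin p) ℝ) (j : Fin p)
    (z : Fin n → Fin p → Bool) (τ : ℝ)
    (h : ∀ s t, |∑ i, (infoTerm (column θ j) j s t (z i) - fisher θ j s t)| ≤ n * τ)
    (u : Fin p → ℝ) :
    n * (u ⬝ᵥ (fisher θ j).mulVec u) ≤ empiricalInfo z (column θ j) j u + n * τ * norm1 u ^ 2 := by
  have e : n * (u ⬝ᵥ (fisher θ j).mulVec u) = empiricalInfo z (column θ j) j u -
      ∑ s, u s * ∑ t, u t * ∑ i, (infoTerm (column θ j) j s t (z i) - fisher θ j s t) := by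
    have e1 : empiricalInfo z (column θ j) j u =
        ∑ s, ∑ t, u s * u t * ∑ i, infoTerm (column θ j) j s t (z i) := by
      unfold empiricalInfo
      simp_rw [← sum_mul_infoTerm, Finset.mul_sum]
      rw [Finset.sum_comm]
      exact Finset.sum_congr rfl fun s _ => Finset.sum_comm
    rw [e1, quadForm_eq_sum, Finset.mul_sum, ← Finset.sum_sub_distrib]
    refine Finset.sum_congr rfl fun s _ => ?_
    rw [Finset.mul_sum, Finset.mul_sum, ← Finset.sum_sub_distrib]
    refine Finset.sum_congr rfl fun t _ => ?_
    rw [Finset.sum_sub_distrib, Finset.sum_const, Finset.card_univ, Fintype.card_fin, nsmul_eq_mul]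
    ring
  have h1 := (abs_le.1 (abs_sum_mul_le u
    (fun s => ∑ t, u t * ∑ i, (infoTerm (column θ j) j s t (z i) - fisher θ j s t))
    (n * τ * norm1 u) fun s => abs_sum_mul_le u _ _ (h s))).1
  rw [e]
  nlinarith

/-! ### Concentration of the score and of the information matrix -/

instance dataLaw_isProbabilityMeasure {p n : ℕ} (θ : Matrix (Fin p) (Fin p) ℝ) :
    IsProbabilityMeasure (dataLaw n θ) := by
  unfold dataLaw; infer_instance

theorem integral_isingPMF {p : ℕ} (θ : Matrix (Fin p) (Fin p) ℝ) (f : (Fin p → Bool) → ℝ) :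
    ∫ x, f x ∂(isingPMF θ).toMeasure = ∑ x, isingDensity θ x * f x := by
  rw [PMF.integral_eq_sum]
  refine Finset.sum_congr rfl fun x _ => ?_
  rw [smul_eq_mul]
  congr 1
  exact ENNReal.toReal_ofReal (isingDensity_nonneg θ x)

/-- Hoeffding: a centred variable in `[-1, 1]` is sub-Gaussian with variance proxy 1, and the rows
are independent. -/
theorem dataLaw_sum_ge_le {p n : ℕ} (θ : Matrix (Fin p) (Fin p) ℝ) (f : (Fin p → Bool) → ℝ)
    (hf : ∀ x, |f x| ≤ 1) (h0 : ∑ x, isingDensity θ x * f x = 0) (t : ℝ) (ht : 0 ≤ t) :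
    dataLaw n θ {z | t ≤ ∑ i, f (z i)} ≤ ENNReal.ofReal (Real.exp (-t ^ 2 / (2 * n))) := by
  have hmeas : Measurable f := measurable_of_countable f
  have hsub : ProbabilityTheory.HasSubgaussianMGF f 1 (isingPMF θ).toMeasure := by
    have := ProbabilityTheory.hasSubgaussianMGF_of_mem_Icc_of_integral_eq_zero
      (μ := (isingPMF θ).toMeasure) (X := f) (a := -1) (b := 1) hmeas.aemeasurable
      (Filter.Eventually.of_forall fun x => abs_le.1 (hf x))
      (by rw [integral_isingPMF]; exact h0)
    convert this using 1
    have : ‖(1 : ℝ) - -1‖₊ = 2 := by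
      rw [← NNReal.coe_inj]; norm_num
    rw [this]
    norm_num
  have hind : ProbabilityTheory.iIndepFun (fun (i : Fin n) (z : Fin n → Fin p → Bool) => f (z i))
      (dataLaw n θ) :=
    ProbabilityTheory.iIndepFun_pi (X := fun _ => f) fun _ => hmeas.aemeasurable
  have hsubi : ∀ i ∈ (Finset.univ : Finset (Fin n)), ProbabilityTheory.HasSubgaussianMGF
      (fun z : Fin n → Fin p → Bool => f (z i)) 1 (dataLaw n θ) := by
    intro i _
    apply ProbabilityTheory.HasSubgaussianMGF.of_map (X := f)
      (Y := fun z : Fin n → Fin p → Bool => z i) (measurable_pi_apply i).aemeasurable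
    have : (dataLaw n θ).map (fun z : Fin n → Fin p → Bool => z i) = (isingPMF θ).toMeasure :=
      (measurePreserving_eval (fun _ : Fin n => (isingPMF θ).toMeasure) i).map_eq
    rw [this]
    exact hsub
  have := ProbabilityTheory.HasSubgaussianMGF.measure_sum_ge_le_of_iIndepFun hind hsubi ht
  rw [← ofReal_measureReal]
  apply ENNReal.ofReal_le_ofReal
  refine this.trans (le_of_eq ?_)
  simp

theorem dataLaw_abs_sum_gt_le {p n : ℕ} (θ : Matrix (Fin p) (Fin p) ℝ) (f : (Fin p → Bool) → ℝ)
    (hf : ∀ x, |f x| ≤ 1) (h0 : ∑ x, isingDensity θ x * f x = 0) (t : ℝ) (ht : 0 ≤ t) :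
    dataLaw n θ {z | t < |∑ i, f (z i)|} ≤
      ENNReal.ofReal (2 * Real.exp (-t ^ 2 / (2 * n))) := by
  have h1 := dataLaw_sum_ge_le (n := n) θ f hf h0 t ht
  have h2 := dataLaw_sum_ge_le (n := n) θ (fun x => -f x) (by simpa using hf)
    (by simpa using h0) t ht
  have hsub : {z : Fin n → Fin p → Bool | t < |∑ i, f (z i)|} ⊆
      {z | t ≤ ∑ i, f (z i)} ∪ {z | t ≤ ∑ i, -f (z i)} := by
    intro z hz
    rcases lt_abs.1 (show t < |∑ i, f (z i)| from hz) with h | h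
    · exact Or.inl h.le
    · right
      change t ≤ ∑ i, -f (z i)
      rw [Finset.sum_neg_distrib]
      exact h.le
  refine (measure_mono hsub).trans ((measure_union_le _ _).trans ((add_le_add h1 h2).trans ?_))
  rw [← ENNReal.ofReal_add (Real.exp_pos _).le (Real.exp_pos _).le]
  exact le_of_eq (by ring_nf)

/-- The event that the scores are at most `l` and that the empirical information matrices are
entrywise `τ`-close to their expectations. -/
def Regular {p n : ℕ} (θ : Matrix (Fin p) (Fin p) ℝ) (l τ : ℝ) (z : Fin n → Fin p → Bool) :
    Prop :=
  (∀ j k, |∑ i, scoreTerm (column θ j) j k (z i)| ≤ l) ∧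
    ∀ j s t, |∑ i, (infoTerm (column θ j) j s t (z i) - fisher θ j s t)| ≤ n * τ

theorem abs_scoreTerm_le {p : ℕ} (a : Fin p → ℝ) (j k : Fin p) (x : Fin p → Bool) :
    |scoreTerm a j k x| ≤ 1 := by
  unfold scoreTerm
  rw [abs_mul, abs_of_nonneg (plugOne_nonneg j x k)]
  apply mul_le_one₀ _ (plugOne_nonneg j x k) (plugOne_le_one j x k)
  rw [abs_le]
  constructor <;> linarith [sigmoid_nonneg (a ⬝ᵥ plugOne j x), sigmoid_le_one (a ⬝ᵥ plugOne j x),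
    bit_nonneg (x j), bit_le_one (x j)]

/-- Each of the `p²` scores and `p³` information entries fails with probability at most `2p⁻⁴`; the
union costs `2/p² + 2/p`. -/
theorem dataLaw_not_regular_le {p n : ℕ} {θ : Matrix (Fin p) (Fin p) ℝ} (hθ : θ.IsSymm)
    (hp : 1 ≤ p) (hn : 1 ≤ n) (l τ : ℝ) (hl : 0 ≤ l) (hτ : 0 ≤ τ)
    (hl' : 8 * n * Real.log p ≤ l ^ 2) (hτ' : 8 * Real.log p ≤ n * τ ^ 2) :
    dataLaw n θ {z | ¬ Regular θ l τ z} ≤ ENNReal.ofReal (4 / p) := by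
  have hp0 : (0 : ℝ) < p := by exact_mod_cast hp
  have hn0 : (0 : ℝ) < n := by exact_mod_cast hn
  set B := ENNReal.ofReal (2 * ((p : ℝ) ^ 4)⁻¹) with hB
  have hexp : ∀ t : ℝ, 8 * n * Real.log p ≤ t ^ 2 →
      ENNReal.ofReal (2 * Real.exp (-t ^ 2 / (2 * n))) ≤ B := by
    intro t ht
    apply ENNReal.ofReal_le_ofReal
    apply mul_le_mul_of_nonneg_left _ (by norm_num)
    have : ((p : ℝ) ^ 4)⁻¹ = Real.exp (-(4 * Real.log p)) := by
      rw [Real.exp_neg, mul_comm, Real.exp_mul, Real.exp_log hp0]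
      norm_cast
    rw [this, Real.exp_le_exp, div_le_iff₀ (by positivity)]
    linarith
  have h1 : ∀ j k, dataLaw n θ {z | l < |∑ i, scoreTerm (column θ j) j k (z i)|} ≤ B :=
    fun j k => (dataLaw_abs_sum_gt_le θ _ (abs_scoreTerm_le _ j k)
      (sum_isingDensity_scoreTerm hθ j k) l hl).trans (hexp l hl')
  have h2 : ∀ j s t, dataLaw n θ
      {z | n * τ < |∑ i, (infoTerm (column θ j) j s t (z i) - fisher θ j s t)|} ≤ B := by
    intro j s t
    refine (dataLaw_abs_sum_gt_le θ (fun x => infoTerm (column θ j) j s t x - fisher θ j s t) ?_ ?_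
      (n * τ) (by positivity)).trans (hexp _ ?_)
    · intro x
      rw [abs_le]
      constructor <;> linarith [infoTerm_nonneg (column θ j) j s t x,
        infoTerm_le (column θ j) j s t x, fisher_nonneg θ j s t, fisher_le θ j s t]
    · simp_rw [mul_sub, Finset.sum_sub_distrib, ← Finset.sum_mul, sum_isingDensity, one_mul,
        fisher_apply, sub_self]
    · have := mul_le_mul_of_nonneg_left hτ' hn0.le
      linarith
  have hsub : {z : Fin n → Fin p → Bool | ¬ Regular θ l τ z} ⊆
      (⋃ j, ⋃ k, {z | l < |∑ i, scoreTerm (column θ j) j k (z i)|}) ∪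
      ⋃ j, ⋃ s, ⋃ t, {z | n * τ < |∑ i, (infoTerm (column θ j) j s t (z i) - fisher θ j s t)|} := by
    intro z hz
    by_contra hcon
    apply hz
    simp only [Set.mem_union, Set.mem_iUnion, Set.mem_ofPred_eq, not_or, not_exists, not_lt] at hcon
    exact hcon
  have hunion : ∀ (S : Fin p → Set (Fin n → Fin p → Bool)) (C : ENNReal),
      (∀ j, dataLaw n θ (S j) ≤ C) → dataLaw n θ (⋃ j, S j) ≤ p * C := by
    intro S C hS
    refine (measure_iUnion_fintype_le _ _).trans ((Finset.sum_le_sum fun j _ => hS j).trans ?_)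
    simp
  calc _ ≤ p * (p * B) + p * (p * (p * B)) :=
        (measure_mono hsub).trans ((measure_union_le _ _).trans (add_le_add
          (hunion _ _ fun j => hunion _ _ (h1 j))
          (hunion _ _ fun j => hunion _ _ fun s => hunion _ _ (h2 j s))))
    _ = ENNReal.ofReal (p * (p * (2 * ((p : ℝ) ^ 4)⁻¹)) +
          p * (p * (p * (2 * ((p : ℝ) ^ 4)⁻¹)))) := by
        rw [ENNReal.ofReal_add (by positivity) (by positivity)]
        simp only [ENNReal.ofReal_mul hp0.le, ENNReal.ofReal_natCast, hB]
    _ ≤ _ := by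
        apply ENNReal.ofReal_le_ofReal
        have hp1 : (1 : ℝ) ≤ p := by exact_mod_cast hp
        rw [le_div_iff₀ hp0]
        have : (p * (p * (2 * ((p : ℝ) ^ 4)⁻¹)) + p * (p * (p * (2 * ((p : ℝ) ^ 4)⁻¹)))) * p =
            2 / p + 2 := by field_simp
        rw [this]
        have : 2 / (p : ℝ) ≤ 2 := div_le_self (by norm_num) hp1
        linarith

/-! ### The sparsity prior -/

theorem SparsityPrior.pow_mul_le {p : ℕ} {c₁ c₂ c₃ c₄ : ℝ} {g : ℕ → ℝ}
    (h : SparsityPrior p c₁ c₂ c₃ c₄ g) (h₁ : 0 ≤ c₁) {m : ℕ} (hm : m ≤ p) :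
    (c₁ / (p : ℝ) ^ c₃) ^ m * g 0 ≤ g m := by
  induction m with
  | zero => simp
  | succ m ih =>
    have h1 := h.lower (m + 1) (by omega) hm
    rw [Nat.add_sub_cancel] at h1
    refine le_trans ?_ h1
    rw [pow_succ', mul_assoc]
    exact mul_le_mul_of_nonneg_left (ih (by omega)) (by positivity)

theorem SparsityPrior.le_pow_mul {p : ℕ} {c₁ c₂ c₃ c₄ : ℝ} {g : ℕ → ℝ}
    (h : SparsityPrior p c₁ c₂ c₃ c₄ g) (h₂ : 0 ≤ c₂) {m : ℕ} (hm : m ≤ p) :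
    g m ≤ (c₂ / (p : ℝ) ^ c₄) ^ m * g 0 := by
  induction m with
  | zero => simp
  | succ m ih =>
    have h1 := h.upper (m + 1) (by omega) hm
    rw [Nat.add_sub_cancel] at h1
    refine h1.trans ?_
    rw [pow_succ', mul_assoc]
    exact mul_le_mul_of_nonneg_left (ih (by omega)) (by positivity)

/-- For `p` this large, each extra active coordinate loses a factor 8 in `g`, which beats the 4 lost
to the wider kernel; a geometric series remains. -/
theorem SparsityPrior.sum_mul_four_pow_le {p : ℕ} {c₁ c₂ c₃ c₄ : ℝ} {g : ℕ → ℝ}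
    (h : SparsityPrior p c₁ c₂ c₃ c₄ g) (h₂ : 0 ≤ c₂) (hp : 0 < p)
    (hpc : 8 * c₂ ≤ (p : ℝ) ^ c₄) :
    ∑ m ∈ Finset.range (p + 1), g m * 4 ^ m ≤ 2 * g 0 := by
  have hp0 : (0 : ℝ) < p := by exact_mod_cast hp
  have hg0 := h.nonneg 0 (Nat.zero_le p)
  calc _ ≤ ∑ m ∈ Finset.range (p + 1), (1 / 2 : ℝ) ^ m * g 0 := by
        refine Finset.sum_le_sum fun m hm => ?_
        have h1 := h.le_pow_mul h₂ (Finset.mem_range_succ_iff.1 hm)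
        have h2 : c₂ / (p : ℝ) ^ c₄ * 4 ≤ 1 / 2 := by
          rw [div_mul_eq_mul_div, div_le_iff₀ (Real.rpow_pos_of_pos hp0 _)]
          linarith
        calc g m * 4 ^ m ≤ (c₂ / (p : ℝ) ^ c₄) ^ m * g 0 * 4 ^ m :=
              mul_le_mul_of_nonneg_right h1 (by positivity)
          _ = (c₂ / (p : ℝ) ^ c₄ * 4) ^ m * g 0 := by rw [mul_pow]; ring
          _ ≤ _ := mul_le_mul_of_nonneg_right (pow_le_pow_left₀ (by positivity) h2 m) hg0
    _ ≤ _ := by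
        rw [← Finset.sum_mul]
        exact mul_le_mul_of_nonneg_right (sum_geometric_two_le _) hg0

/-- Comparison of the prior mass of all models with that of the models of size `s`. -/
theorem SparsityPrior.mass_ratio {p : ℕ} {c₁ c₂ c₃ c₄ : ℝ} {g : ℕ → ℝ}
    (h : SparsityPrior p c₁ c₂ c₃ c₄ g) (h₁ : 0 < c₁) (h₂ : 0 ≤ c₂) (hp : 3 ≤ p)
    (hpc : 8 * c₂ ≤ (p : ℝ) ^ c₄) (hp₁ : 1 / c₁ ≤ p) {s : ℕ} (hs : s ≤ p) (b T : ℝ)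
    (hT : 3 * Real.log p + s * ((c₃ + 2) * Real.log p) + b + s ≤ T) :
    Real.exp (-T) * ∑ m ∈ Finset.range (p + 1), g m * 4 ^ m ≤
      ((p : ℝ) ^ 2)⁻¹ * (Real.exp (-b - s) * (g s / (p.choose s : ℝ))) := by
  have hp0 : (0 : ℝ) < p := by exact_mod_cast (by omega : 0 < p)
  have hg0 := h.nonneg 0 (Nat.zero_le p)
  have hlow := h.pow_mul_le h₁.le hs
  have hch : (p.choose s : ℝ) ≤ Real.exp (s * Real.log p) := by
    rw [Real.exp_nat_mul, Real.exp_log hp0]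
    exact_mod_cast Nat.choose_le_pow p s
  have hch0 : (0 : ℝ) < p.choose s := by exact_mod_cast Nat.choose_pos hs
  -- `1/c₁ ≤ p` turns `c₁ p^{-c₃}` into at least `p^{-(c₃+1)}`; the binomial coefficient costs one
  -- more power of `p` per coordinate.
  have hc : Real.exp (-(s * ((c₃ + 1) * Real.log p))) ≤ (c₁ / (p : ℝ) ^ c₃) ^ s := by
    have e : -(s * ((c₃ + 1) * Real.log p)) = s * (-((c₃ + 1) * Real.log p)) := by ring
    rw [e, Real.exp_nat_mul]
    apply pow_le_pow_left₀ (Real.exp_pos _).le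
    rw [le_div_iff₀ (Real.rpow_pos_of_pos hp0 _), Real.rpow_def_of_pos hp0, ← Real.exp_add]
    have e2 : -((c₃ + 1) * Real.log p) + Real.log p * c₃ = -Real.log p := by ring
    rw [e2, Real.exp_neg, Real.exp_log hp0]
    rw [inv_le_comm₀ hp0 h₁, ← one_div]
    exact hp₁
  have h2 : (2 : ℝ) ≤ Real.exp (Real.log p) := by
    rw [Real.exp_log hp0]; exact_mod_cast (by omega : 2 ≤ p)
  have hpinv : ((p : ℝ) ^ 2)⁻¹ = Real.exp (-(2 * Real.log p)) := by
    rw [Real.exp_neg, mul_comm, Real.exp_mul, Real.exp_log hp0]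
    norm_cast
  have hfrac : Real.exp (-(s * ((c₃ + 2) * Real.log p))) * g 0 ≤ g s / (p.choose s : ℝ) := by
    rw [le_div_iff₀ hch0]
    calc _ ≤ Real.exp (-(s * ((c₃ + 2) * Real.log p))) * g 0 * Real.exp (s * Real.log p) :=
          mul_le_mul_of_nonneg_left hch (by positivity)
      _ = Real.exp (-(s * ((c₃ + 1) * Real.log p))) * g 0 := by
          rw [mul_right_comm, ← Real.exp_add]
          congr 2
          ring
      _ ≤ _ := (mul_le_mul_of_nonneg_right hc hg0).trans hlow
  -- Of the `3 log p` in `hT`, one absorbs the factor 2 of the geometric series and two produce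
  -- `p⁻²`.
  calc _ ≤ Real.exp (-T) * (Real.exp (Real.log p) * g 0) := by
        apply mul_le_mul_of_nonneg_left _ (Real.exp_pos _).le
        exact (h.sum_mul_four_pow_le h₂ (by omega) hpc).trans
          (mul_le_mul_of_nonneg_right h2 hg0)
    _ = Real.exp (-T + Real.log p) * g 0 := by rw [Real.exp_add]; ring
    _ ≤ Real.exp (-(2 * Real.log p) + (-b - s) + -(s * ((c₃ + 2) * Real.log p))) * g 0 := by
        apply mul_le_mul_of_nonneg_right _ hg0
        apply Real.exp_le_exp.2
        linarith
    _ = ((p : ℝ) ^ 2)⁻¹ * (Real.exp (-b - s) *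
          (Real.exp (-(s * ((c₃ + 2) * Real.log p))) * g 0)) := by
        rw [hpinv, Real.exp_add, Real.exp_add]; ring
    _ ≤ _ := by
        apply mul_le_mul_of_nonneg_left _ (by positivity)
        exact mul_le_mul_of_nonneg_left hfrac (Real.exp_pos _).le

/-! ### Restricted eigenvalues as real numbers -/

theorem norm2_sq_pos {p : ℕ} {u : Fin p → ℝ} (hu : u ≠ 0) : 0 < norm2 u ^ 2 := by
  rw [norm2_sq]
  obtain ⟨k, hk⟩ := Function.ne_iff.1 hu
  exact Finset.sum_pos' (fun _ _ => sq_nonneg _) ⟨k, Finset.mem_univ k, sq_pos_of_ne_zero hk⟩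

theorem toReal_mul_le_of_le_rayleigh {p : ℕ} {θ : Matrix (Fin p) (Fin p) ℝ} {j : Fin p}
    {u : Fin p → ℝ} (hu : u ≠ 0) {κ : ENNReal} (h : κ ≤ rayleigh θ j u) :
    κ.toReal * norm2 u ^ 2 ≤ u ⬝ᵥ (fisher θ j).mulVec u := by
  have h1 := ENNReal.toReal_mono ENNReal.ofReal_ne_top h
  rw [ENNReal.toReal_ofReal (div_nonneg (fisher_quadForm_nonneg θ j u) (sq_nonneg _)),
    le_div_iff₀ (norm2_sq_pos hu)] at h1
  exact h1

theorem kappaSparse_le_rayleigh {p : ℕ} (θ : Matrix (Fin p) (Fin p) ℝ) {s : ℕ} (j : Fin p)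
    {u : Fin p → ℝ} (hu : u ≠ 0) (hs : nnz u ≤ s) : kappaSparse θ s ≤ rayleigh θ j u :=
  iInf_le_of_le j (iInf₂_le_of_le u ⟨hu, hs⟩ le_rfl)

theorem kappaCone_le_rayleigh {p : ℕ} (θ : Matrix (Fin p) (Fin p) ℝ) (j : Fin p)
    {u : Fin p → ℝ} (hu : u ≠ 0)
    (hs : ∑ k ∈ Finset.univ.filter (fun k => θ k j = 0), |u k| ≤
      7 * ∑ k ∈ Finset.univ.filter (fun k => θ k j ≠ 0), |u k|) :
    kappaCone θ ≤ rayleigh θ j u :=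
  iInf_le_of_le j (iInf₂_le_of_le u ⟨hu, hs⟩ le_rfl)

/-- A basis vector is admissible, so `toReal` returns the true value and not the default 0. -/
theorem kappaSparse_ne_top {p : ℕ} (θ : Matrix (Fin p) (Fin p) ℝ) {s : ℕ} (hs : 1 ≤ s)
    (j : Fin p) : kappaSparse θ s ≠ ⊤ := by
  have hu : (Pi.single j 1 : Fin p → ℝ) ≠ 0 := by simp
  have hn : nnz (Pi.single j 1 : Fin p → ℝ) ≤ s := by
    have := nnz_add_single_le (0 : Fin p → ℝ) j 1
    rw [zero_add, nnz_zero] at this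
    omega
  exact ((kappaSparse_le_rayleigh θ j hu hn).trans_lt ENNReal.ofReal_lt_top).ne

theorem kappaSparse_toReal_le {p : ℕ} (θ : Matrix (Fin p) (Fin p) ℝ) {s : ℕ} (hs : 1 ≤ s)
    (j : Fin p) : (kappaSparse θ s).toReal ≤ 1 / 4 := by
  have hu : (Pi.single j 1 : Fin p → ℝ) ≠ 0 := by simp
  have hn : nnz (Pi.single j 1 : Fin p → ℝ) ≤ s := by
    have := nnz_add_single_le (0 : Fin p → ℝ) j 1
    rw [zero_add, nnz_zero] at this
    omega
  have h := toReal_mul_le_of_le_rayleigh hu (kappaSparse_le_rayleigh θ j hu hn)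
  have h1 : norm2 (Pi.single j 1 : Fin p → ℝ) ^ 2 = 1 := by
    rw [norm2_sq, Finset.sum_eq_single j]
    · simp
    · intro b _ hb; simp [Pi.single_eq_of_ne hb]
    · simp
  have h2 : (Pi.single j 1 : Fin p → ℝ) ⬝ᵥ (fisher θ j).mulVec (Pi.single j 1) = fisher θ j j j := by
    rw [single_dotProduct, Matrix.mulVec_single]
    simp
  rw [h1, h2, mul_one] at h
  exact h.trans (fisher_le θ j j j)

/-! ### The sparsity levels -/

theorem add_zeta_le_sBar {p : ℕ} (c₄ : ℝ) (θ : Matrix (Fin p) (Fin p) ℝ) (j : Fin p) :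
    (nnz (column θ j) : ℝ) + zeta c₄ θ j ≤ sBar c₄ θ := by
  refine (Nat.le_ceil _).trans ?_
  exact_mod_cast Finset.le_sup (f := fun j : Fin p => ⌈(nnz (column θ j) : ℝ) + zeta c₄ θ j⌉₊)
    (Finset.mem_univ j)

/-- Each bound keeps some of the nonnegative terms of `zeta`. The third ties `s` to `s̄` times the
cone eigenvalue; the fourth controls the second-order error in the normalizing constant. If the cone
eigenvalue is `⊤`, its `toReal` is 0 and the third bound is trivial. -/
theorem sBar_bounds {p : ℕ} {c₄ : ℝ} (h₄ : 0 < c₄) (hp : 3 ≤ p) (θ : Matrix (Fin p) (Fin p) ℝ)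
    (j : Fin p) :
    1 ≤ sBar c₄ θ ∧ 2 * (nnz (column θ j) : ℝ) ≤ sBar c₄ θ ∧
      2 / c₄ * (128 / (kappaCone θ).toReal) * nnz (column θ j) ≤ sBar c₄ θ ∧
      2 / c₄ * (nnz (column θ j) / (64 * Real.log p ^ 2)) * nnz (column θ j) ≤ sBar c₄ θ := by
  have h := add_zeta_le_sBar c₄ θ j
  unfold zeta at h
  rw [ENNReal.toReal_div, ENNReal.toReal_ofNat] at h
  set s : ℝ := (nnz (column θ j) : ℝ) with hs
  have hs0 : 0 ≤ s := Nat.cast_nonneg _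
  have hlp : 0 < Real.log p := Real.log_pos (by exact_mod_cast (by omega : 1 < p))
  have hl4 : 0 ≤ Real.log (4 * Real.exp 1) := by
    apply Real.log_nonneg
    have := Real.add_one_le_exp 1
    linarith
  have e1 : 0 ≤ 2 / c₄ * s := by positivity
  have e2 : 0 ≤ 2 / c₄ * (128 / (kappaCone θ).toReal) * s := by positivity
  have e3 : 0 ≤ 2 / c₄ * (s / (64 * Real.log p ^ 2)) * s := by positivity
  have e4 : 0 ≤ 2 / c₄ * (Real.log (4 * Real.exp 1) / Real.log p) * s := by positivity
  have e5 : 0 < 4 / c₄ := by positivity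
  have hsum : s + (s + 4 / c₄ + (2 / c₄ * s + 2 / c₄ * (128 / (kappaCone θ).toReal) * s +
      2 / c₄ * (s / (64 * Real.log p ^ 2)) * s +
      2 / c₄ * (Real.log (4 * Real.exp 1) / Real.log p) * s)) ≤ sBar c₄ θ := by
    refine le_trans (le_of_eq ?_) h
    ring
  refine ⟨?_, by linarith, by linarith, by linarith⟩
  have : (0 : ℝ) < sBar c₄ θ := by linarith
  exact_mod_cast this

/-! ### Splitting the `ℓ¹` norm over a support and its complement -/

theorem norm1_eq_add {p : ℕ} (a u : Fin p → ℝ) :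
    norm1 u = ∑ k ∈ Finset.univ.filter (fun k => a k ≠ 0), |u k| +
      ∑ k ∈ Finset.univ.filter (fun k => a k = 0), |u k| := by
  unfold norm1
  rw [add_comm, ← Finset.sum_filter_add_sum_filter_not Finset.univ (fun k => a k = 0)]

/-- Off the support of `a` the increment is paid in full; on the support the triangle inequality
limits the gain. -/
theorem norm1_sub_le {p : ℕ} (a u : Fin p → ℝ) :
    norm1 a - norm1 (a + u) ≤ ∑ k ∈ Finset.univ.filter (fun k => a k ≠ 0), |u k| -
      ∑ k ∈ Finset.univ.filter (fun k => a k = 0), |u k| := by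
  have h1 := norm1_eq_add a a
  have h2 := norm1_eq_add a (a + u)
  have h3 : ∑ k ∈ Finset.univ.filter (fun k => a k = 0), |a k| = 0 :=
    Finset.sum_eq_zero fun k hk => by simp [(Finset.mem_filter.1 hk).2]
  have h4 : ∑ k ∈ Finset.univ.filter (fun k => a k = 0), |(a + u) k| =
      ∑ k ∈ Finset.univ.filter (fun k => a k = 0), |u k| :=
    Finset.sum_congr rfl fun k hk => by simp [(Finset.mem_filter.1 hk).2]
  have h5 : ∑ k ∈ Finset.univ.filter (fun k => a k ≠ 0), |a k| ≤
      ∑ k ∈ Finset.univ.filter (fun k => a k ≠ 0), |(a + u) k| +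
      ∑ k ∈ Finset.univ.filter (fun k => a k ≠ 0), |u k| := by
    rw [← Finset.sum_add_distrib]
    refine Finset.sum_le_sum fun k _ => ?_
    have := abs_sub_abs_le_abs_sub (a k) (-u k)
    rw [abs_neg, sub_neg_eq_add] at this
    rw [Pi.add_apply]
    linarith
  linarith

theorem sq_sum_support_le {p : ℕ} (a u : Fin p → ℝ) :
    (∑ k ∈ Finset.univ.filter (fun k => a k ≠ 0), |u k|) ^ 2 ≤ nnz a * norm2 u ^ 2 := by
  refine sq_sum_le_card_mul_sum_sq.trans ?_
  apply mul_le_mul_of_nonneg_left _ (Nat.cast_nonneg _)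
  rw [norm2_sq]
  simp_rw [sq_abs]
  exact Finset.sum_le_sum_of_subset_of_nonneg (Finset.filter_subset _ _) fun _ _ _ => sq_nonneg _

/-! ### Posterior contraction on the regular event -/

/-- The log-likelihood ratio outside a Euclidean ball is dominated by a shifted Laplace kernel. -/
theorem exists_colLogLik_bound (c₄ C : ℝ) (h₄ : 0 < c₄) (hC : 1 ≤ C) :
    ∃ M : ℝ, 2 < M ∧ ∀ (p n : ℕ) (θ : Matrix (Fin p) (Fin p) ℝ) (z : Fin n → Fin p → Bool)
      (j : Fin p), 3 ≤ p → 1 ≤ n → 0 < kappaMin c₄ θ →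
      1296 ^ 2 * ((sBar c₄ θ : ℝ) / (kappaMin c₄ θ).toReal) ^ 2 * Real.log p ≤ n →
      Regular θ (rho n p / 4) ((kappaMin c₄ θ).toReal / (64 * sBar c₄ θ)) z →
      ∀ u : Fin p → ℝ,
        M / (kappaSparse θ (sBar c₄ θ)).toReal * Real.sqrt (sBar c₄ θ * Real.log p / n) <
          norm2 (u - column θ j) →
        colLogLik z j u - colLogLik z j (column θ j) ≤
          rho n p * norm1 u - rho n p * norm1 (column θ j) - C * sBar c₄ θ * Real.log p
            - rho n p / 4 * norm1 (u - column θ j) := by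
  -- The constant `c₄ / 256` comes from the term `(2/c₄)(128/κ₂) s` in `zeta`.
  obtain ⟨M, hM, hrad⟩ := exists_radius (c₄ / 256) C (by positivity) hC
  refine ⟨M, hM, ?_⟩
  intro p n θ z j hp hn hκ hnA hreg u hu
  set a := column θ j with ha
  obtain ⟨d, hd⟩ : ∃ d, d = u - a := ⟨_, rfl⟩
  have hud : u = a + d := by rw [hd]; abel
  rw [← hd] at hu ⊢
  obtain ⟨hsb1, hsb2, hsb3, -⟩ := sBar_bounds h₄ hp θ j
  set sb : ℝ := (sBar c₄ θ : ℝ) with hsb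
  set s : ℝ := (nnz a : ℝ) with hs
  have hsb1' : 1 ≤ sb := by rw [hsb]; exact_mod_cast hsb1
  have hsb0 : 0 < sb := by linarith
  have hn0 : (0 : ℝ) < n := by exact_mod_cast hn
  have hlp : 0 < Real.log p := Real.log_pos (by exact_mod_cast (by omega : 1 < p))
  have hks_top := kappaSparse_ne_top θ hsb1 j
  have hkmin_top : kappaMin c₄ θ ≠ ⊤ := ((min_le_right _ _).trans_lt hks_top.lt_top).ne
  set k := (kappaMin c₄ θ).toReal with hk
  set ks := (kappaSparse θ (sBar c₄ θ)).toReal with hks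
  have hk0 : 0 < k := ENNReal.toReal_pos hκ.ne' hkmin_top
  have hkks : k ≤ ks := ENNReal.toReal_mono hks_top (min_le_right _ _)
  have hks14 : ks ≤ 1 / 4 := kappaSparse_toReal_le θ hsb1 j
  set r := Real.sqrt (Real.log p / n) with hr
  have hr0 : 0 < r := Real.sqrt_pos.2 (by positivity)
  have hr2 : n * r ^ 2 = Real.log p := by
    rw [hr, Real.sq_sqrt (by positivity)]; field_simp
  have hrho : rho n p = 24 * n * r := by
    unfold rho
    have : (n : ℝ) * Real.log p = n ^ 2 * (Real.log p / n) := by field_simp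
    rw [this, Real.sqrt_mul (by positivity), Real.sqrt_sq hn0.le, ← hr]
    ring
  have hrate : Real.sqrt (sb * Real.log p / n) = Real.sqrt sb * r := by
    rw [mul_div_assoc, Real.sqrt_mul hsb0.le]
  -- The sample size condition, in square-root form.
  have hsr : sb * r ≤ k / 1296 := by
    have h1 : (1296 * (sb / k) * r) ^ 2 ≤ 1 ^ 2 := by
      have h2 : (n : ℝ) * (1296 * (sb / k) * r) ^ 2 ≤ n * 1 := by
        calc (n : ℝ) * (1296 * (sb / k) * r) ^ 2 =
              1296 ^ 2 * (sb / k) ^ 2 * (n * r ^ 2) := by ring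
          _ ≤ (n : ℝ) * 1 := by rw [hr2, mul_one]; exact hnA
      have := le_of_mul_le_mul_left h2 hn0
      linarith
    have h3 := le_of_sq_le_sq h1 zero_le_one
    rw [mul_div_assoc', div_mul_eq_mul_div, div_le_iff₀ hk0] at h3
    linarith
  set aS := ∑ i ∈ Finset.univ.filter (fun i => a i ≠ 0), |d i| with haS
  set bS := ∑ i ∈ Finset.univ.filter (fun i => a i = 0), |d i| with hbS
  have hab : norm1 d = aS + bS := norm1_eq_add a d
  have haS0 : 0 ≤ aS := Finset.sum_nonneg fun _ _ => abs_nonneg _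
  have hbS0 : 0 ≤ bS := Finset.sum_nonneg fun _ _ => abs_nonneg _
  set q := empiricalInfo z a j d / n with hq
  have hq0 : 0 ≤ q := div_nonneg (empiricalInfo_nonneg _ _ _ _) hn0.le
  have hnq : empiricalInfo z a j d = n * q := by rw [hq]; field_simp
  have hQ : d ⬝ᵥ (fisher θ j).mulVec d ≤ q + k / (64 * sb) * norm1 d ^ 2 := by
    have h1 := fisher_quadForm_le θ j z (k / (64 * sb)) (fun s t => hreg.2 j s t) d
    rw [← ha, hnq] at h1
    have h2 : (n : ℝ) * (d ⬝ᵥ (fisher θ j).mulVec d) ≤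
        n * (q + k / (64 * sb) * norm1 d ^ 2) := by linarith
    exact le_of_mul_le_mul_left h2 hn0
  have hloglik := colLogLik_sub_le z j a d (rho n p / 4) (fun i => hreg.1 j i)
  have hnorm := norm1_sub_le a d
  rw [hud]
  by_contra hcon
  push Not at hcon
  apply absurd hu
  rw [not_lt, hrate]
  refine hrad s sb r k ks aS bS q (norm2 d) hk0 hkks hks14 hr0 hsb1' (Nat.cast_nonneg _) hsb2 hsr
    haS0 hbS0 (norm2_nonneg d) (sq_sum_support_le a d) hq0 ?_ ?_ ?_
  · intro hba haSpos
    have hd0 : d ≠ 0 := by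
      rintro h0
      rw [haS, h0] at haSpos
      simp at haSpos
    have hcone : kappaCone θ ≤ rayleigh θ j d := kappaCone_le_rayleigh θ j hd0 hba
    -- The deviation itself is a nonzero cone vector, so the infimum is finite.
    have hkc_top : kappaCone θ ≠ ⊤ := (hcone.trans_lt ENNReal.ofReal_lt_top).ne
    have hkkc : k ≤ (kappaCone θ).toReal := ENNReal.toReal_mono hkc_top (min_le_left _ _)
    have hkc0 : 0 < (kappaCone θ).toReal := hk0.trans_le hkkc
    refine ⟨(kappaCone θ).toReal, hkkc, ?_, ?_⟩
    · have e : 2 / c₄ * (128 / (kappaCone θ).toReal) * s =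
          256 * s / (c₄ * (kappaCone θ).toReal) := by field_simp; ring
      rw [e, div_le_iff₀ (by positivity)] at hsb3
      linarith
    · refine (toReal_mul_le_of_le_rayleigh hd0 hcone).trans (hQ.trans (le_of_eq ?_))
      rw [hab]
      ring
  · have h1 := sparse_eigenvalue_transfer (fisher θ j) (fisher_isSymm θ j)
      (fun i => fisher_le θ j i i) (fisher_quadForm_nonneg θ j) ks (hk0.le.trans hkks) hks14
      (sBar c₄ θ) hsb1 (by
        intro x hx
        by_cases hx0 : x = 0
        · subst hx0; simp [norm2]
        · exact toReal_mul_le_of_le_rayleigh hx0 (kappaSparse_le_rayleigh θ j hx0 hx)) d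
    rw [hab] at h1 hQ
    -- The sampling error and the information error each take half of `‖d‖₁²/s̄`.
    have h2 : k / (64 * sb) * (aS + bS) ^ 2 ≤ (aS + bS) ^ 2 / (2 * sb) := by
      rw [div_mul_eq_mul_div, div_le_div_iff₀ (by positivity) (by positivity)]
      have : 0 ≤ (aS + bS) ^ 2 * sb := by positivity
      have h3 : k * ((aS + bS) ^ 2 * sb) ≤ 1 * ((aS + bS) ^ 2 * sb) :=
        mul_le_mul_of_nonneg_right (by linarith) this
      linarith
    have h4 : (aS + bS) ^ 2 / (2 * sb) + (aS + bS) ^ 2 / (2 * sb) = (aS + bS) ^ 2 / sb := by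
      field_simp; ring
    linarith
  · rw [hab, hnq, mul_div_assoc] at hloglik
    rw [hab] at hcon
    -- Score and Laplace kernel each take `ρ/4` of the penalty: `ρ(aS - bS) + (ρ/2)(aS + bS)` is
    -- `n(36 r aS - 12 r bS)`, as `ρ = 24 n r`.
    have hcon' : 0 ≤ rho n p * (norm1 a - norm1 (a + d) ) + C * sb * Real.log p +
        rho n p / 4 * (aS + bS) + (rho n p / 4 * (aS + bS) - n * (q / (2 * (1 + (aS + bS))))) := by
      linarith
    have hmul : rho n p * (norm1 a - norm1 (a + d)) ≤ rho n p * (aS - bS) :=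
      mul_le_mul_of_nonneg_left hnorm (by rw [hrho]; positivity)
    rw [hrho, ← hr2] at hcon'
    rw [hrho] at hmul
    have hfin : 0 ≤ n * (36 * r * aS - 12 * r * bS - q / (2 * (1 + (aS + bS))) +
        C * sb * r ^ 2) := by linarith
    have := nonneg_of_mul_nonneg_right hfin hn0
    linarith

/-- Contraction of one column of the quasi-posterior on the regular event. -/
theorem exists_quasiPosterior_column_le (c₁ c₂ c₃ c₄ : ℝ) (h₁ : 0 < c₁) (h₂ : 0 < c₂)
    (h₄ : 0 < c₄) (h₃ : c₄ ≤ c₃) :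
    ∃ M : ℝ, 2 < M ∧ ∀ (p n : ℕ) (g : ℕ → ℝ) (θ : Matrix (Fin p) (Fin p) ℝ)
      (z : Fin n → Fin p → Bool) (j : Fin p), SparsityPrior p c₁ c₂ c₃ c₄ g → 3 ≤ p →
      8 * c₂ ≤ (p : ℝ) ^ c₄ → 1 / c₁ ≤ p → 1 ≤ n → 0 < kappaMin c₄ θ →
      1296 ^ 2 * ((sBar c₄ θ : ℝ) / (kappaMin c₄ θ).toReal) ^ 2 * Real.log p ≤ n →
      Regular θ (rho n p / 4) ((kappaMin c₄ θ).toReal / (64 * sBar c₄ θ)) z →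
      quasiPosterior g (rho n p) z {ϑ | column ϑ j ∈ {u : Fin p → ℝ |
        M / (kappaSparse θ (sBar c₄ θ)).toReal * Real.sqrt (sBar c₄ θ * Real.log p / n) <
          norm2 (u - column θ j)}} ≤ ENNReal.ofReal ((p : ℝ) ^ 2)⁻¹ := by
  -- The budget in units of `s̄ log p`: 3 and `c₃ + 2` from the mass ratio, `1/4 + c₄` from the
  -- log-likelihood loss on the box, 1 from its penalty.
  obtain ⟨M, hM, hbound⟩ := exists_colLogLik_bound c₄ (c₃ + c₄ + 7) h₄ (by linarith)
  refine ⟨M, hM, ?_⟩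
  intro p n g θ z j hg hp hpc hp₁ hn hκ hnA hreg
  set a := column θ j with ha
  obtain ⟨hsb1, hsb2, -, hsb4⟩ := sBar_bounds h₄ hp θ j
  have hn0 : (0 : ℝ) < n := by exact_mod_cast hn
  have hlp1 : 1 ≤ Real.log p := by
    rw [Real.le_log_iff_exp_le (by exact_mod_cast (by omega : 0 < p))]
    have h3 : (3 : ℝ) ≤ p := by exact_mod_cast hp
    linarith [Real.exp_one_lt_d9]
  have hlp : 0 < Real.log p := by linarith
  have hrho : 0 < rho n p := by unfold rho; positivity
  have hrho2 : rho n p ^ 2 = 576 * (n * Real.log p) := by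
    unfold rho
    rw [mul_pow, Real.sq_sqrt (by positivity)]
    norm_num
  have hA : MeasurableSet {u : Fin p → ℝ |
      M / (kappaSparse θ (sBar c₄ θ)).toReal * Real.sqrt (sBar c₄ θ * Real.log p / n) <
        norm2 (u - a)} :=
    measurableSet_lt measurable_const (measurable_norm2.comp (measurable_id.sub_const a))
  refine quasiPosterior_column_le hg.nonneg hrho z j _ hA _ ?_
  set sb : ℝ := (sBar c₄ θ : ℝ) with hsb
  set s : ℝ := (nnz a : ℝ) with hs
  have hs0 : 0 ≤ s := Nat.cast_nonneg _
  have hsb1' : 1 ≤ sb := by rw [hsb]; exact_mod_cast hsb1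
  -- Keeps the box, of `ℓ¹` radius `s/ρ`, inside the unit ball where the upper logistic bound holds.
  have hsrho : s ≤ rho n p := by
    have hks_top := kappaSparse_ne_top θ hsb1 j
    have hkmin_top : kappaMin c₄ θ ≠ ⊤ := ((min_le_right _ _).trans_lt hks_top.lt_top).ne
    have hk0 : 0 < (kappaMin c₄ θ).toReal := ENNReal.toReal_pos hκ.ne' hkmin_top
    have hk1 : (kappaMin c₄ θ).toReal ≤ 1 :=
      (ENNReal.toReal_mono hks_top (min_le_right _ _)).trans
        ((kappaSparse_toReal_le θ hsb1 j).trans (by norm_num))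
    have h5 : sb ≤ sb / (kappaMin c₄ θ).toReal := by
      rw [le_div_iff₀ hk0]
      exact mul_le_of_le_one_right (by linarith) hk1
    have h6 : sb ^ 2 ≤ n := by
      have h7 := pow_le_pow_left₀ (by linarith) h5 2
      have h8 : (sb / (kappaMin c₄ θ).toReal) ^ 2 * 1 ≤
          (sb / (kappaMin c₄ θ).toReal) ^ 2 * Real.log p :=
        mul_le_mul_of_nonneg_left hlp1 (sq_nonneg _)
      have h9 : 0 ≤ (sb / (kappaMin c₄ θ).toReal) ^ 2 * Real.log p := by positivity
      linarith
    apply le_of_sq_le_sq _ hrho.le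
    rw [hrho2]
    have h10 : s ^ 2 ≤ sb ^ 2 := pow_le_pow_left₀ hs0 (by linarith) 2
    have h11 : (n : ℝ) * 1 ≤ n * Real.log p := mul_le_mul_of_nonneg_left hlp1 hn0.le
    linarith
  -- On the box the score loses `(ρ/4)(s/ρ) = s/4` and the second-order term `n(s/ρ)² = s²/(576 log
  -- p)`.
  refine column_posterior_le hg.nonneg hrho (colLogLik z j) (measurable_colLogLik z j) a
    (s / 4 + s ^ 2 / (576 * Real.log p)) ((c₃ + c₄ + 7) * sb * Real.log p) ((p : ℝ) ^ 2)⁻¹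
    (by positivity) _ hA ?_ ?_ ?_
  · intro u hu
    rw [← hs] at hu
    have h1 : norm1 (u - a) ≤ 1 := hu.trans ((div_le_one hrho).2 hsrho)
    have h2 := le_colLogLik_sub z j a (u - a) (rho n p / 4) (fun i => hreg.1 j i) h1
    rw [add_sub_cancel] at h2
    have h3 : rho n p / 4 * norm1 (u - a) ≤ s / 4 := by
      have := mul_le_mul_of_nonneg_left hu (by positivity : 0 ≤ rho n p / 4)
      refine this.trans (le_of_eq ?_)
      field_simp
    have h4 : n * norm1 (u - a) ^ 2 ≤ s ^ 2 / (576 * Real.log p) := by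
      have h5 := pow_le_pow_left₀ (norm1_nonneg _) hu 2
      have h6 := mul_le_mul_of_nonneg_left h5 hn0.le
      refine h6.trans (le_of_eq ?_)
      rw [div_pow, hrho2]
      field_simp
    linarith
  · intro u hu
    exact hbound p n θ z j hp hn hκ hnA hreg u hu
  · have hsp : nnz a ≤ p := by
      have := Finset.card_filter_le (Finset.univ : Finset (Fin p)) (fun k => a k ≠ 0)
      simpa [nnz] using this
    refine hg.mass_ratio h₁ h₂.le hp hpc hp₁ hsp _ _ ?_
    change 3 * Real.log p + s * ((c₃ + 2) * Real.log p) +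
      (s / 4 + s ^ 2 / (576 * Real.log p)) + s ≤ _
    have e : 2 / c₄ * (s / (64 * Real.log p ^ 2)) * s = s ^ 2 / (32 * c₄ * Real.log p ^ 2) := by
      field_simp; ring
    rw [e, div_le_iff₀ (by positivity)] at hsb4
    have h1 : s ^ 2 / (576 * Real.log p) ≤ c₄ * sb * Real.log p := by
      rw [div_le_iff₀ (by positivity)]
      have : 0 ≤ c₄ * sb * Real.log p ^ 2 := by positivity
      linarith
    have h2 : s ≤ s * Real.log p := le_mul_of_one_le_right hs0 hlp1
    have h3 : Real.log p ≤ sb * Real.log p := le_mul_of_one_le_left hlp.le hsb1'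
    have h4 : s * Real.log p ≤ sb * Real.log p :=
      mul_le_mul_of_nonneg_right (by linarith) hlp.le
    have h5 : c₃ * (s * Real.log p) ≤ c₃ * (sb * Real.log p) :=
      mul_le_mul_of_nonneg_left h4 (by linarith)
    linarith

end IsingQuasi

/-! ### Union over the columns and average over the data -/

theorem theorem4 :
    ∃ A₁ A₂ : ℝ, 0 < A₁ ∧ 0 < A₂ ∧
      ∀ c₁ c₂ c₃ c₄ : ℝ, 0 < c₁ → 0 < c₂ → 0 < c₄ → c₄ ≤ c₃ →
        ∃ M₀ : ℝ, 2 < M₀ ∧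
          ∃ p₀ : ℕ, ∀ p : ℕ, p₀ ≤ p →
            ∀ g : ℕ → ℝ, IsingQuasi.SparsityPrior p c₁ c₂ c₃ c₄ g →
            ∀ θs : Matrix (Fin p) (Fin p) ℝ, θs.IsSymm →
            0 < IsingQuasi.kappaMin c₄ θs →
            ∀ n : ℕ,
              A₁ * ((IsingQuasi.sBar c₄ θs : ℝ) / (IsingQuasi.kappaMin c₄ θs).toReal) ^ 2
                  * Real.log p ≤ n →
              ∫⁻ z : Fin n → Fin p → Bool,
                  IsingQuasi.quasiPosterior g (IsingQuasi.rho n p) z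
                    {θ | M₀ / (IsingQuasi.kappaSparse θs (IsingQuasi.sBar c₄ θs)).toReal
                        * Real.sqrt (IsingQuasi.sBar c₄ θs * Real.log p / n)
                        < IsingQuasi.maxColNorm (θ - θs)}
                  ∂(IsingQuasi.dataLaw n θs)
                ≤ ENNReal.ofReal (2 * Real.exp (-A₂ * n) + 12 / p) := by
  -- The argument yields `5/p`, so any positive rate `A₂` would do.
  refine ⟨1296 ^ 2, 1, by norm_num, one_pos, ?_⟩
  intro c₁ c₂ c₃ c₄ h₁ h₂ h₄ h₃
  obtain ⟨M, hM, hcolumn⟩ := IsingQuasi.exists_quasiPosterior_column_le c₁ c₂ c₃ c₄ h₁ h₂ h₄ h₃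
  refine ⟨M, hM, ?_⟩
  obtain ⟨p₀, hp₀⟩ := Filter.eventually_atTop.1
    (((((tendsto_rpow_atTop h₄).comp tendsto_natCast_atTop_atTop).eventually_ge_atTop (8 * c₂)).and
      ((tendsto_natCast_atTop_atTop (R := ℝ)).eventually_ge_atTop (1 / c₁))).and
      (Filter.eventually_ge_atTop (3 : ℕ)))
  refine ⟨p₀, ?_⟩
  intro p hpp g hg θs hθ hκ n hn
  obtain ⟨⟨hpc, hp₁⟩, hp⟩ := hp₀ p hpp
  have hp0 : (0 : ℝ) < p := by exact_mod_cast (by omega : 0 < p)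
  have hne : Nonempty (Fin p) := ⟨⟨0, by omega⟩⟩
  obtain ⟨j₀⟩ := hne
  have hlp : 0 < Real.log p := Real.log_pos (by exact_mod_cast (by omega : 1 < p))
  have hsb1 := (IsingQuasi.sBar_bounds h₄ hp θs j₀).1
  have hsb0 : (0 : ℝ) < IsingQuasi.sBar c₄ θs := by exact_mod_cast hsb1
  have hkmin_top : IsingQuasi.kappaMin c₄ θs ≠ ⊤ :=
    ((min_le_right _ _).trans_lt (IsingQuasi.kappaSparse_ne_top θs hsb1 j₀).lt_top).ne
  have hk0 : 0 < (IsingQuasi.kappaMin c₄ θs).toReal := ENNReal.toReal_pos hκ.ne' hkmin_top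
  have hn0 : (0 : ℝ) < n := lt_of_lt_of_le (by positivity) hn
  have hn1 : 1 ≤ n := by exact_mod_cast hn0
  set τ := (IsingQuasi.kappaMin c₄ θs).toReal / (64 * IsingQuasi.sBar c₄ θs) with hτ
  set A := {θ | M / (IsingQuasi.kappaSparse θs (IsingQuasi.sBar c₄ θs)).toReal
    * Real.sqrt (IsingQuasi.sBar c₄ θs * Real.log p / n) < IsingQuasi.maxColNorm (θ - θs)} with hA
  set bad := {z : Fin n → Fin p → Bool |
    ¬ IsingQuasi.Regular θs (IsingQuasi.rho n p / 4) τ z} with hbad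
  have hbad_le : IsingQuasi.dataLaw n θs bad ≤ ENNReal.ofReal (4 / p) := by
    apply IsingQuasi.dataLaw_not_regular_le hθ (by omega) hn1
    · unfold IsingQuasi.rho; positivity
    · positivity
    · unfold IsingQuasi.rho
      rw [div_pow, mul_pow, Real.sq_sqrt (by positivity)]
      have : 0 ≤ n * Real.log p := by positivity
      linarith
    -- The lower bound on `n` gives `n τ² ≥ (1296²/4096) log p`, well above `8 log p`.
    · have e : 1296 ^ 2 * ((IsingQuasi.sBar c₄ θs : ℝ) / (IsingQuasi.kappaMin c₄ θs).toReal) ^ 2 *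
          Real.log p * τ ^ 2 = 1296 ^ 2 / 4096 * Real.log p := by
        rw [hτ]; field_simp; norm_num
      have := mul_le_mul_of_nonneg_right hn (sq_nonneg τ)
      rw [e] at this
      linarith
  have hgood : ∀ z ∉ bad, IsingQuasi.quasiPosterior g (IsingQuasi.rho n p) z A ≤
      ENNReal.ofReal (1 / p) := by
    intro z hz
    have hreg : IsingQuasi.Regular θs (IsingQuasi.rho n p / 4) τ z := not_not.1 hz
    have hsub : A ⊆ ⋃ j, {θ | IsingQuasi.column θ j ∈ {u : Fin p → ℝ |
        M / (IsingQuasi.kappaSparse θs (IsingQuasi.sBar c₄ θs)).toReal *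
          Real.sqrt (IsingQuasi.sBar c₄ θs * Real.log p / n) <
          IsingQuasi.norm2 (u - IsingQuasi.column θs j)}} := by
      intro θ hθA
      have : Nonempty (Fin p) := ⟨j₀⟩
      obtain ⟨j, hj⟩ :=
        exists_lt_of_lt_ciSup (show _ < ⨆ j, IsingQuasi.norm2 (IsingQuasi.column (θ - θs) j) from hθA)
      exact Set.mem_iUnion.2 ⟨j, hj⟩
    refine (measure_mono hsub).trans ((measure_iUnion_fintype_le _ _).trans ?_)
    refine (Finset.sum_le_sum fun j _ =>
      hcolumn p n g θs z j hg hp hpc hp₁ hn1 hκ hn hreg).trans ?_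
    rw [Finset.sum_const, Finset.card_univ, Fintype.card_fin, nsmul_eq_mul,
      ← ENNReal.ofReal_natCast, ← ENNReal.ofReal_mul hp0.le]
    apply ENNReal.ofReal_le_ofReal
    exact le_of_eq (by field_simp)
  calc _ ≤ ∫⁻ z, (ENNReal.ofReal (1 / p) + bad.indicator 1 z) ∂(IsingQuasi.dataLaw n θs) := by
        -- On the bad event the quasi-posterior mass is bounded by 1.
        refine lintegral_mono fun z => ?_
        by_cases hz : z ∈ bad
        · rw [Set.indicator_of_mem hz]
          exact (IsingQuasi.quasiPosterior_le_one g _ z A).trans le_add_self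
        · rw [Set.indicator_of_notMem hz, add_zero]
          exact hgood z hz
    _ = ENNReal.ofReal (1 / p) + IsingQuasi.dataLaw n θs bad := by
        rw [lintegral_add_left measurable_const, lintegral_const, measure_univ, mul_one,
          lintegral_indicator_one (Set.toFinite _).measurableSet]
    _ ≤ ENNReal.ofReal (1 / p) + ENNReal.ofReal (4 / p) := add_le_add le_rfl hbad_le
    _ ≤ _ := by
        rw [← ENNReal.ofReal_add (by positivity) (by positivity)]
        apply ENNReal.ofReal_le_ofReal
        have h5 : 1 / (p : ℝ) + 4 / p ≤ 12 / p := by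
          rw [← add_div]
          exact div_le_div_of_nonneg_right (by norm_num) hp0.le
        have := Real.exp_pos (-1 * (n : ℝ))
        linarith
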